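/- Let $\alpha\in(0,1)$, let $\tau_0,k_0,\rho^*>0$ and $e_0\in\mathbb R$ be constants, and let the viscous coefficient satisfy $\mu:=\mu(\varepsilon_0)>0$ at a fixed deformation $\varepsilon_0$. Let $E_\alpha(z)=\sum_{k\ge0}z^k/\Gamma(\alpha k+1)$ be the Mittag-Leffler function and let $$D^\alpha f(t)=\frac1{\Gamma(1-\alpha)}\int_0^t (t-s)^{-\alpha}f'(s)\,ds$$ be the Caputo derivative. Consider the viscous energy $e^{(V)}$, a function of the stress $\sigma$, given in the parametric form $$e^{(V)}(s)=e_0-\frac{k_0^2}{\rho^*\mu}\int_0^s E_\alpha\big[-(\bar s/\tau_0)^\alpha\big]^2\,d\bar s,\qquad \sigma(s)=k_0E_\alpha\big[-(s/\tau_0)^\alpha\big],\qquad s\ge0.$$ The map $s\mapsto\sigma(s)$ is a bijection of $[0,\infty)$ onto $(0,k_0]$, so that $e^{(V)}$ is a well-defined function of $\sigma\in(0,k_0]$; it is differentiable there (one-sidedly at $k_0$). Write $e^{(V)}_\sigma$ for its derivative. Then: 1. The function $\sigma(t)=k_0E_\alpha[-(t/\tau_0)^\alpha]$, which satisfies $\sigma(0)=k_0$,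 is for $t>0$ a solution, continuous on $[0,\infty)$, of both the nonlinear relaxation equation $$\sigma+\rho^*\mu\,\frac{e^{(V)}_\sigma(\sigma)}{\sigma}\,\dot\sigma=0$$ and the fractional Maxwell relaxation equation $\sigma+\tau_0^\alpha D^\alpha\sigma=0$; as a solution of the latter it is absolutely continuous on every $[0,T]$. Conversely, every common solution $\sigma$ of these two equations, in the same sense and with values in $(0,k_0]$, has $\sigma(0)=k_0$. 2. The energy $e^{(V)}(\sigma)$ is bounded on $[0,k_0]$ (whatever finite value is given to it at $\sigma=0$) if and only if the function $s\mapsto E_\alpha[-(s/\tau_0)^\alpha]$ belongs to $L^2([0,\infty))$, and this holds if and only if $\alpha\in(1/2,1)$. 3. The nonlinear relaxation time $\tau(\varepsilon_0,\sigma)=\rho^*\mu\,e^{(V)}_\sigma(\sigma)/\sigma$ is positive for all $\sigma\in(0,k_0)$, tends to $+\infty$ as $\sigma\to0^+$, is equal to $0$ at $\sigma=k_0$, and tends to $0$ as $\sigma\to k_0^-$. 4. If $\alpha\in(1/2,1)$ and $e_0$ is chosen as $$e_0=\frac{k_0^2}{\rho^*\mu}\int_0^\infty E_\alpha\big[-(\bar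 s/\tau_0)^\alpha\big]^2\,d\bar s,$$ then $\lim_{\sigma\to0^+}e^{(V)}(\sigma)=0$. -/

import Mathlib

open Set Filter Topology MeasureTheory

noncomputable section

/-- The Mittag-Leffler function `E_β(z) = ∑ z ^ k / Γ(β k + 1)` at a real argument `z`
(the series converges for every `z` when `0 < β`). -/
def mittagLeffler (β z : ℝ) : ℝ :=
  ∑' k : ℕ, z ^ k / Real.Gamma (β * (k : ℝ) + 1)

/-- The stress `σ(s) = k₀ E_α[-(s/τ₀)^α]`, meant for `0 ≤ s`. -/
def relaxationStress (α τ₀ k₀ s : ℝ) : ℝ :=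
  k₀ * mittagLeffler α (-(s / τ₀) ^ α)

/-- The energy along the parametrization, as a function of the parameter `0 ≤ s`:
`e₀ - k₀² / (ρ m) ∫₀ˢ E_α[-(r/τ₀)^α]² dr`, where `m` is the value of the viscous coefficient. -/
def parametricEnergy (α τ₀ k₀ ρ m e₀ s : ℝ) : ℝ :=
  e₀ - k₀ ^ 2 / (ρ * m) * ∫ r in (0 : ℝ)..s, (mittagLeffler α (-(r / τ₀) ^ α)) ^ 2

/-- `eV`, as a function of the stress, is given by the parametric form
`s ↦ (relaxationStress s, parametricEnergy s)`, `0 ≤ s`. The curve covers the stresses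
in `(0, k₀]`; nothing is imposed on `eV` elsewhere. -/
def IsViscousEnergy (α τ₀ k₀ ρ m e₀ : ℝ) (eV : ℝ → ℝ) : Prop :=
  ∀ s : ℝ, 0 ≤ s → eV (relaxationStress α τ₀ k₀ s) = parametricEnergy α τ₀ k₀ ρ m e₀ s

/-- The nonlinear relaxation time `τ(ε, σ) = ρ μ(ε) e_σ(σ) / σ`. The derivative is taken within
the interval `(0, k₀]` of stresses on which the energy is given: it is the ordinary derivative at
interior points and the left derivative at `k₀`. -/
def relaxationTime (ρ : ℝ) (μ : ℝ → ℝ) (k₀ : ℝ) (eV : ℝ → ℝ) (ε σ : ℝ) : ℝ :=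
  ρ * μ ε * (derivWithin eV (Ioc 0 k₀) σ / σ)

/-- `σ` solves the nonlinear relaxation equation `σ + ρ μ(ε₀) (e_σ(σ) / σ) σ' = 0` for `0 < t`
(at constant deformation `ε₀`), with stress values in the interval on which the energy is given,
and is continuous up to `t = 0`. -/
structure IsNonlinearRelaxation (ρ : ℝ) (μ : ℝ → ℝ) (k₀ : ℝ) (eV : ℝ → ℝ) (ε₀ : ℝ)
    (σ : ℝ → ℝ) : Prop where
  continuousOn : ContinuousOn σ (Ici 0)
  mem_domain : ∀ t : ℝ, 0 ≤ t → σ t ∈ Ioc 0 k₀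
  differentiableAt : ∀ t : ℝ, 0 < t → DifferentiableAt ℝ σ t
  equation : ∀ t : ℝ, 0 < t →
    σ t + ρ * μ ε₀ * (derivWithin eV (Ioc 0 k₀) (σ t) / σ t) * deriv σ t = 0

/-- The Caputo derivative of order `α ∈ (0, 1)` with base point `0`:
`D^α f (t) = Γ(1 - α)⁻¹ ∫₀ᵗ (t - s)^(-α) f'(s) ds`. -/
def caputoDeriv (α : ℝ) (f : ℝ → ℝ) (t : ℝ) : ℝ :=
  (Real.Gamma (1 - α))⁻¹ * ∫ s in (0 : ℝ)..t, (t - s) ^ (-α) * deriv f s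

/-- `σ` solves the fractional Maxwell relaxation equation `σ + τ₀^α D^α σ = 0` for `0 < t`:
`σ` is absolutely continuous on every `[0, T]`, the integral in the Caputo derivative converges
for `0 < t`, and the equation holds for `0 < t`. -/
structure IsFractionalMaxwellRelaxation (α τ₀ : ℝ) (σ : ℝ → ℝ) : Prop where
  absolutelyContinuous : ∀ T : ℝ, 0 < T → AbsolutelyContinuousOnInterval σ 0 T
  integrable : ∀ t : ℝ, 0 < t →
    IntervalIntegrable (fun s : ℝ => (t - s) ^ (-α) * deriv σ s) volume 0 t
  equation : ∀ t : ℝ, 0 < t → σ t + τ₀ ^ α * caputoDeriv α σ t = 0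

end

/-! Everything rests on the kernels `t ^ (β - 1) E_{α,β}(-t ^ α)`. Fractional integration of order
`γ` sends `β` to `β + γ` (`integral_sub_rpow_mul_mittagLefflerKernel`), and shifting the series
relates `β` to `β + α` (`mittagLefflerKernel_eq_sub`). For `τ₀ = 1` write `g` and `v` for the
kernels with `β = 1` and `β = α`. Then `g' = -v`, the Caputo derivative of `g` is `-g`, and `v`
solves a weakly singular Volterra equation. That equation gives `v > 0` by a first-zero argument
(`mittagLefflerKernel_self_pos`), without Laplace transforms or complete monotonicity. Positivity
then yields monotonicity of `g`, decay of `g` comparable to `t ^ (-α)`, and `t v ≤ α`.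

Along the parametric curve the energy has derivative `-(k₀² / (ρ μ)) g²` and the stress `-k₀ v`, so
the relaxation time is `g / v`; its limits follow from the bounds above. Boundedness of the energy
is integrability of `g²`, hence of `t ^ (-2α)` at infinity.

For the converse, a solution of the nonlinear equation is a translate `k₀ g(t + d)` with `d ≥ 0`
(`exists_eq_shift`). If `d > 0` its derivative is bounded near `0`, so its Caputo derivative tends
to `0` there, and the fractional equation forces initial value `0`, contradicting positivity. Only
`d = 0` remains. -/

/-! ### Mittag-Leffler series, kernels and their fractional integrals. -/

/-- Log-convexity of `Γ` between `x + α - 1` and `x + α`, combined with the functional equation. It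
controls the ratio of consecutive series coefficients. -/
theorem Real.rpow_mul_Gamma_le_Gamma_add {α x : ℝ} (hα₀ : 0 < α) (hα₁ : α < 1) (hx : 1 < x) :
    (x + α - 1) ^ α * Real.Gamma x ≤ Real.Gamma (x + α) := by
  have hy : 0 < x + α - 1 := by linarith
  have hG : 0 < Real.Gamma (x + α - 1) := Real.Gamma_pos_of_pos hy
  have h := Real.Gamma_mul_add_mul_le_rpow_Gamma_mul_rpow_Gamma
    (s := x + α) (t := x + α - 1) (a := 1 - α) (b := α) (by linarith) hy
    (by linarith) hα₀ (by ring)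
  have e : (1 - α) * (x + α) + α * (x + α - 1) = x := by ring
  have e2 : Real.Gamma (x + α) = (x + α - 1) * Real.Gamma (x + α - 1) := by
    rw [← Real.Gamma_add_one hy.ne']; ring_nf
  rw [e] at h
  calc (x + α - 1) ^ α * Real.Gamma x
      ≤ (x + α - 1) ^ α * (Real.Gamma (x + α) ^ (1 - α) * Real.Gamma (x + α - 1) ^ α) := by gcongr
    _ = Real.Gamma (x + α) ^ (1 - α) * Real.Gamma (x + α) ^ α := by
        rw [mul_left_comm, ← Real.mul_rpow hy.le hG.le, ← e2]
    _ = Real.Gamma (x + α) := by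
        rw [← Real.rpow_add (Real.Gamma_pos_of_pos (by linarith))]; simp

/-- The two-parameter Mittag-Leffler function `E_{α,β}(z) = ∑ z ^ k / Γ(α k + β)`. -/
noncomputable def mittagLefflerTwo (α β z : ℝ) : ℝ :=
  ∑' k : ℕ, z ^ k / Real.Gamma (α * (k : ℝ) + β)

/-- The function `t ^ (β - 1) E_{α,β}(-t ^ α)`. -/
noncomputable def mittagLefflerKernel (α β t : ℝ) : ℝ :=
  t ^ (β - 1) * mittagLefflerTwo α β (-t ^ α)

theorem summable_mittagLeffler {α β : ℝ} (hα₀ : 0 < α) (hα₁ : α < 1) (hβ : 0 < β) (z : ℝ) :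
    Summable fun k : ℕ => z ^ k / Real.Gamma (α * (k : ℝ) + β) := by
  have hlin : Tendsto (fun k : ℕ => α * (k : ℝ) + β) atTop atTop :=
    tendsto_atTop_add_const_right _ _ (tendsto_natCast_atTop_atTop.const_mul_atTop hα₀)
  have hpow : Tendsto (fun k : ℕ => (α * (k : ℝ) + β + α - 1) ^ α) atTop atTop :=
    (tendsto_rpow_atTop hα₀).comp
      ((tendsto_atTop_add_const_right _ (α - 1) hlin).congr fun k => by ring)
  refine summable_of_ratio_norm_eventually_le (r := 1 / 2) (by norm_num) ?_
  filter_upwards [hlin.eventually_gt_atTop 1, hpow.eventually_ge_atTop (2 * |z|)] with k h1 h2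
  have hG : 0 < Real.Gamma (α * (k : ℝ) + β) := Real.Gamma_pos_of_pos (by linarith)
  have h3 := Real.rpow_mul_Gamma_le_Gamma_add hα₀ hα₁ h1
  have hG' : 0 < Real.Gamma (α * (k : ℝ) + β + α) := Real.Gamma_pos_of_pos (by linarith)
  have e : α * ((k + 1 : ℕ) : ℝ) + β = α * (k : ℝ) + β + α := by push_cast; ring
  rw [e, norm_div, norm_div, norm_pow, norm_pow, Real.norm_of_nonneg hG.le,
    Real.norm_of_nonneg hG'.le, Real.norm_eq_abs, pow_succ, div_le_iff₀ hG']
  have h4 : 2 * |z| * Real.Gamma (α * (k : ℝ) + β) ≤ Real.Gamma (α * (k : ℝ) + β + α) :=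
    (mul_le_mul_of_nonneg_right h2 hG.le).trans h3
  have h5 : 0 ≤ |z| ^ k / Real.Gamma (α * (k : ℝ) + β) := by positivity
  calc |z| ^ k * |z| = 1 / 2 * (|z| ^ k / Real.Gamma (α * (k : ℝ) + β)) *
        (2 * |z| * Real.Gamma (α * (k : ℝ) + β)) := by field_simp
    _ ≤ _ := by gcongr

theorem continuous_mittagLefflerTwo {α β : ℝ} (hα₀ : 0 < α) (hα₁ : α < 1) (hβ : 0 < β) :
    Continuous (mittagLefflerTwo α β) := by
  rw [continuous_iff_continuousAt]
  intro x
  have : ContinuousOn (mittagLefflerTwo α β) (Icc (-(|x| + 1)) (|x| + 1)) := by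
    refine continuousOn_tsum (fun k => by fun_prop)
      (summable_mittagLeffler hα₀ hα₁ hβ (|x| + 1)) fun k y hy => ?_
    have hG : 0 < Real.Gamma (α * (k : ℝ) + β) := Real.Gamma_pos_of_pos (by positivity)
    rw [norm_div, norm_pow, Real.norm_of_nonneg hG.le, Real.norm_eq_abs]
    gcongr
    exact abs_le.2 hy
  exact this.continuousAt (Icc_mem_nhds (by linarith [neg_abs_le x]) (by linarith [le_abs_self x]))

theorem mittagLefflerTwo_one (α z : ℝ) : mittagLefflerTwo α 1 z = mittagLeffler α z := rfl

theorem mittagLefflerTwo_zero (α β : ℝ) :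
    mittagLefflerTwo α β 0 = (Real.Gamma β)⁻¹ := by
  rw [mittagLefflerTwo, tsum_eq_single 0 (fun k hk => by simp [hk])]
  simp

theorem mittagLefflerKernel_one (α t : ℝ) :
    mittagLefflerKernel α 1 t = mittagLeffler α (-t ^ α) := by
  simp [mittagLefflerKernel, mittagLefflerTwo_one]

theorem mittagLefflerKernel_term {α β t : ℝ} (ht : 0 < t) (k : ℕ) :
    t ^ (β - 1) * ((-t ^ α) ^ k / Real.Gamma (α * (k : ℝ) + β)) =
      (-1) ^ k / Real.Gamma (α * (k : ℝ) + β) * t ^ (α * (k : ℝ) + β - 1) := by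
  have : t ^ (α * (k : ℝ) + β - 1) = t ^ (β - 1) * (t ^ α) ^ k := by
    rw [← Real.rpow_mul_natCast ht.le, ← Real.rpow_add ht]; ring_nf
  rw [this, neg_pow]; ring

theorem summable_mittagLefflerKernel {α β t : ℝ} (hα₀ : 0 < α) (hα₁ : α < 1) (hβ : 0 < β)
    (ht : 0 < t) :
    Summable fun k : ℕ =>
      (-1) ^ k / Real.Gamma (α * (k : ℝ) + β) * t ^ (α * (k : ℝ) + β - 1) := by
  simp_rw [← mittagLefflerKernel_term ht]
  exact (summable_mittagLeffler hα₀ hα₁ hβ _).mul_left _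

theorem mittagLefflerKernel_eq_tsum {α β t : ℝ} (ht : 0 < t) :
    mittagLefflerKernel α β t = ∑' k : ℕ,
      (-1) ^ k / Real.Gamma (α * (k : ℝ) + β) * t ^ (α * (k : ℝ) + β - 1) := by
  simp_rw [← mittagLefflerKernel_term ht]
  rw [tsum_mul_left]; rfl

/-- Split off the term `k = 0`; the rest is the series for `β + α` with opposite sign, since `α (k +
1) + β = α k + (β + α)`. -/
theorem mittagLefflerKernel_eq_sub {α β t : ℝ} (hα₀ : 0 < α) (hα₁ : α < 1) (hβ : 0 < β)
    (ht : 0 < t) :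
    mittagLefflerKernel α β t =
      t ^ (β - 1) / Real.Gamma β - mittagLefflerKernel α (β + α) t := by
  rw [mittagLefflerKernel_eq_tsum ht, mittagLefflerKernel_eq_tsum ht,
    (summable_mittagLefflerKernel hα₀ hα₁ hβ ht).tsum_eq_zero_add,
    sub_eq_add_neg (t ^ (β - 1) / Real.Gamma β), ← tsum_neg]
  congr 1
  · simp; ring
  · refine tsum_congr fun k => ?_
    have e : α * ((k + 1 : ℕ) : ℝ) + β = α * (k : ℝ) + (β + α) := by push_cast; ring
    rw [e, pow_succ]; ring

theorem continuousOn_mittagLefflerKernel {α β : ℝ} (hα₀ : 0 < α) (hα₁ : α < 1) (hβ : 0 < β) :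
    ContinuousOn (mittagLefflerKernel α β) (Ioi 0) := by
  refine ContinuousOn.mul (fun t ht => (Real.continuousAt_rpow_const _ _
    (Or.inl (ne_of_gt ht))).continuousWithinAt) (Continuous.continuousOn ?_)
  exact (continuous_mittagLefflerTwo hα₀ hα₁ hβ).comp (Real.continuous_rpow_const hα₀.le).neg

theorem intervalIntegrable_sub_rpow_mul_rpow {γ β t : ℝ} (hγ : 0 < γ) (hβ : 0 < β) (ht : 0 < t) :
    IntervalIntegrable (fun s => (t - s) ^ (γ - 1) * s ^ (β - 1)) volume 0 t := by
  -- On the left half only the singularity at `0` matters, so no sign of `γ` is needed; the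
  -- reflection `s ↦ t - s` with `γ` and `β` swapped gives the right half.
  have key : ∀ γ β : ℝ, 0 < β →
      IntervalIntegrable (fun s => (t - s) ^ (γ - 1) * s ^ (β - 1)) volume 0 (t / 2) := by
    intro γ β hβ
    refine (intervalIntegral.intervalIntegrable_rpow' (by linarith)).continuousOn_mul ?_
    intro s hs
    rw [uIcc_of_le (by positivity)] at hs
    have hts : t - s ≠ 0 := ne_of_gt (by linarith [hs.2])
    exact (ContinuousAt.rpow_const (by fun_prop) (Or.inl hts)).continuousWithinAt
  refine (key γ β hβ).trans ?_
  have h := ((key β γ hγ).comp_sub_left t).symm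
  simp only [sub_sub_cancel, sub_zero] at h
  rw [show t - t / 2 = t / 2 by ring] at h
  exact h.congr (fun s _ => mul_comm _ _)

theorem integral_sub_rpow_mul_rpow {γ β t : ℝ} (hγ : 0 < γ) (hβ : 0 < β) (ht : 0 < t) :
    ∫ s in (0 : ℝ)..t, (t - s) ^ (γ - 1) * s ^ (β - 1) =
      Real.Gamma γ * Real.Gamma β / Real.Gamma (β + γ) * t ^ (β + γ - 1) := by
  have h := Complex.betaIntegral_scaled β γ ht
  rw [Complex.betaIntegral_eq_Gamma_mul_div _ _ (by simpa) (by simpa)] at h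
  rw [← Complex.ofReal_inj, ← intervalIntegral.integral_ofReal]
  refine Eq.trans (intervalIntegral.integral_congr fun s hs => ?_) (h.trans ?_)
  · rw [uIcc_of_le ht.le] at hs
    have h1 : 0 ≤ t - s := sub_nonneg.2 hs.2
    rw [Complex.ofReal_mul, Complex.ofReal_cpow h1, Complex.ofReal_cpow hs.1]
    push_cast; ring
  · rw [← Complex.ofReal_add, Complex.Gamma_ofReal, Complex.Gamma_ofReal, Complex.Gamma_ofReal]
    push_cast [Complex.ofReal_cpow ht.le]; ring

theorem intervalIntegrable_sub_rpow_mul_mittagLefflerKernel {α β γ t : ℝ} (hα₀ : 0 < α)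
    (hα₁ : α < 1) (hβ : 0 < β) (hγ : 0 < γ) (ht : 0 < t) :
    IntervalIntegrable (fun s => (t - s) ^ (γ - 1) * mittagLefflerKernel α β s) volume 0 t := by
  have h := (intervalIntegrable_sub_rpow_mul_rpow hγ hβ ht).mul_continuousOn
    (((continuous_mittagLefflerTwo hα₀ hα₁ hβ).comp
      (Real.continuous_rpow_const hα₀.le).neg).continuousOn)
  exact h.congr (fun s _ => by simp [mittagLefflerKernel, mul_assoc])

/-- The fractional integral of order `γ` raises the second parameter by `γ`. -/
theorem integral_sub_rpow_mul_mittagLefflerKernel {α β γ t : ℝ} (hα₀ : 0 < α) (hα₁ : α < 1)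
    (hβ : 0 < β) (hγ : 0 < γ) (ht : 0 < t) :
    ∫ s in (0 : ℝ)..t, (t - s) ^ (γ - 1) * mittagLefflerKernel α β s =
      Real.Gamma γ * mittagLefflerKernel α (β + γ) t := by
  set c : ℕ → ℝ := fun k => (-1) ^ k / Real.Gamma (α * (k : ℝ) + β) with hc
  set F : ℕ → ℝ → ℝ := fun k s => c k * ((t - s) ^ (γ - 1) * s ^ (α * (k : ℝ) + β - 1)) with hF
  have hb : ∀ k : ℕ, 0 < α * (k : ℝ) + β := fun k => by positivity
  have hint : ∀ k : ℕ, ∫ s in Ioc 0 t, (t - s) ^ (γ - 1) * s ^ (α * (k : ℝ) + β - 1) =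
      Real.Gamma γ * Real.Gamma (α * (k : ℝ) + β) / Real.Gamma (α * (k : ℝ) + (β + γ)) *
        t ^ (α * (k : ℝ) + (β + γ) - 1) := fun k => by
    rw [← intervalIntegral.integral_of_le ht.le, integral_sub_rpow_mul_rpow hγ (hb k) ht, add_assoc]
  have hi : ∀ k, Integrable (F k) (volume.restrict (Ioc 0 t)) := fun k =>
    (((intervalIntegrable_iff_integrableOn_Ioc_of_le ht.le).1
      (intervalIntegrable_sub_rpow_mul_rpow hγ (hb k) ht))).const_mul _
  have hcabs : ∀ k, |c k| = (Real.Gamma (α * (k : ℝ) + β))⁻¹ := fun k => by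
    rw [hc]; simp only [abs_div, abs_pow, abs_neg, abs_one, one_pow, one_div]
    rw [abs_of_pos (Real.Gamma_pos_of_pos (hb k))]
  have hnorm : ∀ k, ∫ s in Ioc 0 t, ‖F k s‖ = ‖Real.Gamma γ *
      ((-1) ^ k / Real.Gamma (α * (k : ℝ) + (β + γ)) * t ^ (α * (k : ℝ) + (β + γ) - 1))‖ := by
    intro k
    have h1 : ∫ s in Ioc 0 t, ‖F k s‖ =
        ∫ s in Ioc 0 t, |c k| * ((t - s) ^ (γ - 1) * s ^ (α * (k : ℝ) + β - 1)) := by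
      refine setIntegral_congr_fun measurableSet_Ioc fun s hs => ?_
      have h2 : 0 ≤ t - s := sub_nonneg.2 hs.2
      have h3 : 0 ≤ s := hs.1.le
      simp only [hF, Real.norm_eq_abs, abs_mul]
      rw [abs_of_nonneg (Real.rpow_nonneg h2 _), abs_of_nonneg (Real.rpow_nonneg h3 _)]
    have hG := Real.Gamma_pos_of_pos (hb k)
    have hG' : 0 < Real.Gamma (α * (k : ℝ) + (β + γ)) := Real.Gamma_pos_of_pos (by positivity)
    have hGg := Real.Gamma_pos_of_pos hγ
    rw [h1, integral_const_mul, hint, hcabs]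
    simp only [Real.norm_eq_abs, abs_mul, abs_div, abs_pow, abs_neg, abs_one, one_pow]
    rw [abs_of_pos hG', abs_of_pos hGg, abs_of_pos (Real.rpow_pos_of_pos ht _)]
    field_simp
  -- The integrated norms are the norms of the terms of the series for `β + γ`, up to the factor
  -- `Γ(γ)`, so absolute convergence of that series justifies the interchange.
  have hS := integral_tsum_of_summable_integral_norm hi (by
    simp_rw [hnorm]
    exact ((summable_mittagLefflerKernel hα₀ hα₁ (by positivity) ht).mul_left _).norm)
  rw [intervalIntegral.integral_of_le ht.le, mittagLefflerKernel_eq_tsum ht, ← tsum_mul_left]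
  refine Eq.trans (setIntegral_congr_fun measurableSet_Ioc fun s hs => ?_)
    (hS.symm.trans (tsum_congr fun k => ?_))
  · simp only [hF]
    rw [mittagLefflerKernel_eq_tsum hs.1, ← tsum_mul_left]
    exact tsum_congr fun k => by ring
  · simp only [hF]
    have hG := Real.Gamma_pos_of_pos (hb k)
    rw [integral_const_mul, hint, hc]
    field_simp

theorem tendsto_rpow_mul_mittagLefflerKernel {α β : ℝ} (hα₀ : 0 < α) (hα₁ : α < 1) (hβ : 0 < β) :
    Tendsto (fun t => t ^ (1 - β) * mittagLefflerKernel α β t) (𝓝[>] 0)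
      (𝓝 (Real.Gamma β)⁻¹) := by
  have hc : Continuous fun t : ℝ => mittagLefflerTwo α β (-t ^ α) :=
    (continuous_mittagLefflerTwo hα₀ hα₁ hβ).comp (Real.continuous_rpow_const hα₀.le).neg
  have h := (hc.tendsto 0).mono_left (nhdsWithin_le_nhds (s := Ioi 0))
  simp only [Real.zero_rpow hα₀.ne', neg_zero, mittagLefflerTwo_zero] at h
  refine h.congr' ?_
  filter_upwards [self_mem_nhdsWithin] with t ht
  rw [mittagLefflerKernel, ← mul_assoc, ← Real.rpow_add ht]
  simp

/-! ### Volterra equation and positivity of the kernel `β = α`. -/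

/-- The kernel `u = t ^ (α - 1) E_{α,α}(-t ^ α)` solves a Volterra equation. -/
theorem Gamma_mul_mittagLefflerKernel_self {α t : ℝ} (hα₀ : 0 < α) (hα₁ : α < 1) (ht : 0 < t) :
    Real.Gamma α * mittagLefflerKernel α α t =
      t ^ (α - 1) - ∫ s in (0 : ℝ)..t, (t - s) ^ (α - 1) * mittagLefflerKernel α α s := by
  have hG := Real.Gamma_pos_of_pos hα₀
  rw [integral_sub_rpow_mul_mittagLefflerKernel hα₀ hα₁ hα₀ hα₀ ht,
    mittagLefflerKernel_eq_sub hα₀ hα₁ hα₀ ht]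
  field_simp

theorem integral_sub_rpow {α s t : ℝ} (hα₀ : 0 < α) :
    ∫ r in s..t, (t - r) ^ (α - 1) = (t - s) ^ α / α := by
  rw [intervalIntegral.integral_comp_sub_left (fun x => x ^ (α - 1)) t,
    integral_rpow (Or.inl (by linarith))]
  simp [Real.zero_rpow hα₀.ne']

/-- The exponent is negative, so this reduces to `T (t - s) ≤ (T - s) t`. Relative to the forcing `t
^ (α - 1)`, the weight of a past time `s` does not increase with `t`. -/
theorem sub_rpow_mul_rpow_le {α s t T : ℝ} (hα₁ : α < 1) (hs : 0 < s) (hst : s < t) (htT : t ≤ T) :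
    (T - s) ^ (α - 1) * t ^ (α - 1) ≤ T ^ (α - 1) * (t - s) ^ (α - 1) := by
  have h1 : 0 < t - s := sub_pos.2 hst
  rw [← Real.mul_rpow (by linarith) (by linarith), ← Real.mul_rpow (by linarith) (by linarith)]
  refine Real.rpow_le_rpow_of_nonpos (mul_pos (by linarith) h1) ?_ (by linarith)
  nlinarith

/-- At a first time `T` with `u T ≤ 0`, the memory integral must be at least the forcing `T ^ (α -
1)`. Split it at a point `p` close to `T`. By `sub_rpow_mul_rpow_le` the part before `p`, relative
to the forcing, is no larger than it was at `p`, which leaves a slack proportional to `Γ(α) u p`.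
The part after `p` has a short range and cannot fill it. -/
theorem mittagLefflerKernel_self_pos {α t : ℝ} (hα₀ : 0 < α) (hα₁ : α < 1) (ht : 0 < t) :
    0 < mittagLefflerKernel α α t := by
  set u := mittagLefflerKernel α α with hu
  have hG := Real.Gamma_pos_of_pos hα₀
  have hcont : ContinuousOn u (Ioi 0) := continuousOn_mittagLefflerKernel hα₀ hα₁ hα₀
  obtain ⟨ε, hε, hεu⟩ : ∃ ε > 0, ∀ s ∈ Ioo 0 ε, 0 < u s := by
    have h := (tendsto_rpow_mul_mittagLefflerKernel hα₀ hα₁ hα₀).eventually_const_lt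
      (inv_pos.2 hG)
    obtain ⟨ε, hε, h⟩ := mem_nhdsGT_iff_exists_Ioo_subset.1 h
    exact ⟨ε, hε, fun s hs => pos_of_mul_pos_right (h hs) (Real.rpow_nonneg hs.1.le _)⟩
  by_contra! hneg
  have hεt : ε ≤ t := not_lt.1 fun h => absurd (hεu t ⟨ht, h⟩) hneg.not_gt
  have hsub : Icc ε t ⊆ Ioi 0 := fun s hs => lt_of_lt_of_le hε hs.1
  have hclosed : IsClosed (Icc ε t ∩ u ⁻¹' Iic 0) :=
    (hcont.mono hsub).preimage_isClosed_of_isClosed isClosed_Icc isClosed_Iic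
  obtain ⟨T, hT⟩ := (isCompact_Icc.of_isClosed_subset hclosed inter_subset_left).exists_isLeast
    ⟨t, ⟨hεt, le_rfl⟩, hneg⟩
  have hT0 : 0 < T := hsub hT.1.1
  have huT : u T ≤ 0 := hT.1.2
  have hpos : ∀ s ∈ Ioo 0 T, 0 < u s := by
    intro s hs
    by_contra! h
    have hεs : ε ≤ s := not_lt.1 fun h' => absurd (hεu s ⟨hs.1, h'⟩) h.not_gt
    exact (hT.2 ⟨⟨hεs, hs.2.le.trans hT.1.1.2⟩, h⟩).not_gt hs.2
  -- `δ < T / 2` keeps `p ≥ T / 2`, so passing from `p ^ (α - 1)` to `T ^ (α - 1)` costs at most a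
  -- factor `2`; the last condition makes the recent memory less than half the slack.
  obtain ⟨δ, hδ0, hδT, hδ⟩ : ∃ δ : ℝ, 0 < δ ∧ δ < T / 2 ∧ δ ^ α / α < Real.Gamma α / 2 := by
    have h1 : Tendsto (fun δ : ℝ => δ ^ α / α) (𝓝[>] 0) (𝓝 0) := by
      have := (((Real.continuous_rpow_const hα₀.le).div_const α).tendsto 0).mono_left
        (nhdsWithin_le_nhds (s := Ioi 0))
      simpa [Real.zero_rpow hα₀.ne'] using this
    obtain ⟨δ, h, h'⟩ := ((h1.eventually_lt_const (half_pos hG)).and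
      (Ioo_mem_nhdsGT (half_pos hT0))).exists
    exact ⟨δ, h'.1, h'.2, h⟩
  -- Splitting at a maximum point bounds `u` on `(p, T)` by `u p`, the same quantity that measures
  -- the slack.
  obtain ⟨p, hp, hmax⟩ := isCompact_Icc.exists_isMaxOn
    (nonempty_Icc.2 (by linarith : T - δ ≤ T))
    (hcont.mono fun s hs => (lt_of_lt_of_le (by linarith) hs.1 : (0 : ℝ) < s))
  have hup : 0 < u p := lt_of_lt_of_le (hpos (T - δ / 2) ⟨by linarith, by linarith⟩)
    (hmax ⟨by linarith, by linarith⟩)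
  have hp0 : 0 < p := lt_of_lt_of_le (by linarith) hp.1
  have hpT : p < T := lt_of_le_of_ne hp.2 fun h => by rw [h] at hup; linarith
  have hIT := intervalIntegrable_sub_rpow_mul_mittagLefflerKernel hα₀ hα₁ hα₀ hα₀ hT0
  have hIp := intervalIntegrable_sub_rpow_mul_mittagLefflerKernel hα₀ hα₁ hα₀ hα₀ hp0
  rw [← hu] at hIT hIp
  have hpm : p ∈ uIcc 0 T := by rw [uIcc_of_le hT0.le]; exact ⟨hp0.le, hpT.le⟩
  have hI1 : IntervalIntegrable (fun s => (T - s) ^ (α - 1) * u s) volume 0 p :=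
    hIT.mono_set (uIcc_subset_uIcc left_mem_uIcc hpm)
  have hI2 : IntervalIntegrable (fun s => (T - s) ^ (α - 1) * u s) volume p T :=
    hIT.mono_set (uIcc_subset_uIcc hpm right_mem_uIcc)
  have hvT := Gamma_mul_mittagLefflerKernel_self hα₀ hα₁ hT0
  have hvp := Gamma_mul_mittagLefflerKernel_self hα₀ hα₁ hp0
  rw [← hu] at hvT hvp
  rw [← intervalIntegral.integral_add_adjacent_intervals hI1 hI2] at hvT
  have hA : p ^ (α - 1) * ∫ s in (0 : ℝ)..p, (T - s) ^ (α - 1) * u s ≤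
      T ^ (α - 1) * ∫ s in (0 : ℝ)..p, (p - s) ^ (α - 1) * u s := by
    rw [← intervalIntegral.integral_const_mul, ← intervalIntegral.integral_const_mul]
    refine intervalIntegral.integral_mono_on_of_le_Ioo hp0.le (hI1.const_mul _) (hIp.const_mul _)
      fun s hs => ?_
    have h1 := mul_le_mul_of_nonneg_right (sub_rpow_mul_rpow_le hα₁ hs.1 hs.2 hpT.le)
      (hpos s ⟨hs.1, hs.2.trans hpT⟩).le
    calc _ = (T - s) ^ (α - 1) * p ^ (α - 1) * u s := by ring
      _ ≤ _ := h1
      _ = _ := by ring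
  have hB : ∫ s in p..T, (T - s) ^ (α - 1) * u s ≤ (T - p) ^ α / α * u p := by
    rw [← integral_sub_rpow hα₀, ← intervalIntegral.integral_mul_const]
    refine intervalIntegral.integral_mono_on_of_le_Ioo hpT.le hI2 ?_ fun s hs => ?_
    · have h := ((intervalIntegral.intervalIntegrable_rpow' (a := T - p) (b := 0)
        (by linarith : -1 < α - 1)).comp_sub_left T).mul_const (u p)
      simpa using h
    · exact mul_le_mul_of_nonneg_left (hmax ⟨hp.1.trans hs.1.le, hs.2.le⟩)
        (Real.rpow_nonneg (sub_nonneg.2 hs.2.le) _)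
  have hK : 0 < p ^ (α - 1) := Real.rpow_pos_of_pos hp0 _
  have hr : p ^ (α - 1) / 2 ≤ T ^ (α - 1) := by
    have h1 : (T / p) ^ (α - 1) = T ^ (α - 1) / p ^ (α - 1) := Real.div_rpow hT0.le hp0.le _
    have h2 : T / p ≤ 2 := by rw [div_le_iff₀ hp0]; linarith [hp.1]
    have h3 : (2 : ℝ) ^ (-1 : ℝ) ≤ (T / p) ^ (α - 1) := by
      calc (2 : ℝ) ^ (-1 : ℝ) ≤ 2 ^ (α - 1) :=
            Real.rpow_le_rpow_of_exponent_le (by norm_num) (by linarith)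
        _ ≤ _ := Real.rpow_le_rpow_of_nonpos (by positivity) h2 (by linarith)
    rw [h1, le_div_iff₀ hK, Real.rpow_neg_one] at h3
    linarith
  have hC : (T - p) ^ α / α ≤ δ ^ α / α := by
    have : T - p ≤ δ := by linarith [hp.1]
    have h' : 0 ≤ T - p := by linarith
    gcongr
  have h1 : T ^ (α - 1) ≤ (∫ s in (0 : ℝ)..p, (T - s) ^ (α - 1) * u s) +
      (T - p) ^ α / α * u p := by
    have := mul_nonpos_of_nonneg_of_nonpos hG.le huT
    linarith
  have h2 : (∫ s in (0 : ℝ)..p, (p - s) ^ (α - 1) * u s) =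
      p ^ (α - 1) - Real.Gamma α * u p := by linarith
  rw [h2] at hA
  have h3 : T ^ (α - 1) * (Real.Gamma α * u p) ≤ p ^ (α - 1) * ((T - p) ^ α / α * u p) := by
    nlinarith [mul_le_mul_of_nonneg_left h1 hK.le]
  have h4 : p ^ (α - 1) * ((T - p) ^ α / α * u p) < p ^ (α - 1) * (Real.Gamma α / 2 * u p) := by
    have := hC.trans_lt hδ
    gcongr
  have h5 : p ^ (α - 1) / 2 * (Real.Gamma α * u p) ≤ T ^ (α - 1) * (Real.Gamma α * u p) := by
    gcongr
  linarith

/-! ### Monotonicity, decay and square integrability of the kernel `β = 1`. -/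

theorem mittagLefflerKernel_one_zero {α : ℝ} (hα₀ : 0 < α) : mittagLefflerKernel α 1 0 = 1 := by
  rw [mittagLefflerKernel_one, Real.zero_rpow hα₀.ne', neg_zero, ← mittagLefflerTwo_one,
    mittagLefflerTwo_zero, Real.Gamma_one, inv_one]

theorem continuous_mittagLefflerKernel_one {α : ℝ} (hα₀ : 0 < α) (hα₁ : α < 1) :
    Continuous (mittagLefflerKernel α 1) := by
  rw [funext (mittagLefflerKernel_one α)]
  exact (continuous_mittagLefflerTwo hα₀ hα₁ one_pos).comp
    (Real.continuous_rpow_const hα₀.le).neg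

theorem intervalIntegrable_mittagLefflerKernel_self {α t : ℝ} (hα₀ : 0 < α) (hα₁ : α < 1)
    (ht : 0 ≤ t) : IntervalIntegrable (mittagLefflerKernel α α) volume 0 t := by
  rcases ht.eq_or_lt with rfl | ht
  · exact IntervalIntegrable.refl
  · simpa using intervalIntegrable_sub_rpow_mul_mittagLefflerKernel hα₀ hα₁ hα₀ one_pos ht

theorem mittagLefflerKernel_one_eq_sub_integral {α t : ℝ} (hα₀ : 0 < α) (hα₁ : α < 1)
    (ht : 0 ≤ t) :
    mittagLefflerKernel α 1 t = 1 - ∫ s in (0 : ℝ)..t, mittagLefflerKernel α α s := by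
  rcases ht.eq_or_lt with rfl | ht
  · simp [mittagLefflerKernel_one_zero hα₀]
  · have h := integral_sub_rpow_mul_mittagLefflerKernel hα₀ hα₁ hα₀ one_pos ht
    simp only [sub_self, Real.rpow_zero, one_mul, Real.Gamma_one] at h
    rw [h, mittagLefflerKernel_eq_sub hα₀ hα₁ one_pos ht, add_comm 1 α]
    simp

/-- Differentiating the integral identity avoids termwise differentiation of the series. -/
theorem hasDerivAt_mittagLefflerKernel_one {α t : ℝ} (hα₀ : 0 < α) (hα₁ : α < 1) (ht : 0 < t) :
    HasDerivAt (mittagLefflerKernel α 1) (-mittagLefflerKernel α α t) t := by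
  have hc := continuousOn_mittagLefflerKernel hα₀ hα₁ hα₀
  have h := (intervalIntegral.integral_hasDerivAt_right
    (intervalIntegrable_mittagLefflerKernel_self hα₀ hα₁ ht.le)
    (hc.stronglyMeasurableAtFilter isOpen_Ioi t ht)
    (hc.continuousAt (Ioi_mem_nhds ht))).const_sub 1
  refine h.congr_of_eventuallyEq ?_
  filter_upwards [Ioi_mem_nhds ht] with s hs
  exact mittagLefflerKernel_one_eq_sub_integral hα₀ hα₁ (le_of_lt hs)

theorem strictAntiOn_mittagLefflerKernel_one {α : ℝ} (hα₀ : 0 < α) (hα₁ : α < 1) :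
    StrictAntiOn (mittagLefflerKernel α 1) (Ici 0) := by
  refine strictAntiOn_of_deriv_neg (convex_Ici 0)
    (continuous_mittagLefflerKernel_one hα₀ hα₁).continuousOn fun t ht => ?_
  rw [interior_Ici] at ht
  rw [(hasDerivAt_mittagLefflerKernel_one hα₀ hα₁ ht).deriv]
  exact neg_neg_of_pos (mittagLefflerKernel_self_pos hα₀ hα₁ ht)

/-- Order `1 - α` raises `β = α` to `β = 1`; this is the fractional Maxwell equation for `τ₀ = 1`.
-/
theorem integral_sub_rpow_neg_mul_mittagLefflerKernel {α t : ℝ} (hα₀ : 0 < α) (hα₁ : α < 1)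
    (ht : 0 < t) :
    ∫ s in (0 : ℝ)..t, (t - s) ^ (-α) * mittagLefflerKernel α α s =
      Real.Gamma (1 - α) * mittagLefflerKernel α 1 t := by
  have h := integral_sub_rpow_mul_mittagLefflerKernel hα₀ hα₁ hα₀ (sub_pos.2 hα₁) ht
  simpa using h

theorem intervalIntegrable_sub_rpow_neg_mul_mittagLefflerKernel {α t : ℝ} (hα₀ : 0 < α)
    (hα₁ : α < 1) (ht : 0 < t) :
    IntervalIntegrable (fun s => (t - s) ^ (-α) * mittagLefflerKernel α α s) volume 0 t := by
  have h := intervalIntegrable_sub_rpow_mul_mittagLefflerKernel hα₀ hα₁ hα₀ (sub_pos.2 hα₁) ht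
  simpa using h

/-- Bound `(t - s) ^ (-α)` below by `t ^ (-α)` in the Caputo integral. This yields both positivity
and the lower decay rate. -/
theorem rpow_neg_mul_one_sub_le_mittagLefflerKernel_one {α t : ℝ} (hα₀ : 0 < α) (hα₁ : α < 1)
    (ht : 0 < t) :
    t ^ (-α) * (1 - mittagLefflerKernel α 1 t) ≤
      Real.Gamma (1 - α) * mittagLefflerKernel α 1 t := by
  rw [← integral_sub_rpow_neg_mul_mittagLefflerKernel hα₀ hα₁ ht,
    mittagLefflerKernel_one_eq_sub_integral hα₀ hα₁ ht.le, sub_sub_cancel,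
    ← intervalIntegral.integral_const_mul]
  refine intervalIntegral.integral_mono_on_of_le_Ioo ht.le
    ((intervalIntegrable_mittagLefflerKernel_self hα₀ hα₁ ht.le).const_mul _)
    (intervalIntegrable_sub_rpow_neg_mul_mittagLefflerKernel hα₀ hα₁ ht) fun s hs => ?_
  exact mul_le_mul_of_nonneg_right
    (Real.rpow_le_rpow_of_nonpos (sub_pos.2 hs.2) (by linarith [hs.1]) (by linarith))
    (mittagLefflerKernel_self_pos hα₀ hα₁ hs.1).le

theorem mittagLefflerKernel_one_pos {α t : ℝ} (hα₀ : 0 < α) (hα₁ : α < 1) (ht : 0 ≤ t) :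
    0 < mittagLefflerKernel α 1 t := by
  rcases ht.eq_or_lt with rfl | ht
  · simp [mittagLefflerKernel_one_zero hα₀]
  · have h1 : mittagLefflerKernel α 1 t < 1 := by
      conv_rhs => rw [← mittagLefflerKernel_one_zero hα₀]
      exact strictAntiOn_mittagLefflerKernel_one hα₀ hα₁ self_mem_Ici ht.le ht
    have h2 := rpow_neg_mul_one_sub_le_mittagLefflerKernel_one hα₀ hα₁ ht
    exact pos_of_mul_pos_right
      ((mul_pos (Real.rpow_pos_of_pos ht _) (sub_pos.2 h1)).trans_le h2)
      (Real.Gamma_pos_of_pos (sub_pos.2 hα₁)).le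

/-- By monotonicity, the fractional integral of order `α` of the decreasing kernel is at least `t ^
α / α` times its value at `t`; the series shift bounds that integral by `Γ(α)`. -/
theorem mittagLefflerKernel_one_le {α t : ℝ} (hα₀ : 0 < α) (hα₁ : α < 1) (ht : 0 < t) :
    mittagLefflerKernel α 1 t ≤ α * Real.Gamma α * t ^ (-α) := by
  have hG := Real.Gamma_pos_of_pos hα₀
  have hf := mittagLefflerKernel_one_pos hα₀ hα₁ ht.le
  have h : t ^ α / α * mittagLefflerKernel α 1 t ≤ Real.Gamma α * 1 := by
    calc t ^ α / α * mittagLefflerKernel α 1 t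
        = ∫ s in (0 : ℝ)..t, (t - s) ^ (α - 1) * mittagLefflerKernel α 1 t := by
          rw [intervalIntegral.integral_mul_const, integral_sub_rpow hα₀, sub_zero]
      _ ≤ ∫ s in (0 : ℝ)..t, (t - s) ^ (α - 1) * mittagLefflerKernel α 1 s := by
          refine intervalIntegral.integral_mono_on_of_le_Ioo ht.le ?_
            (intervalIntegrable_sub_rpow_mul_mittagLefflerKernel hα₀ hα₁ one_pos hα₀ ht)
            fun s hs => ?_
          · simpa using ((intervalIntegral.intervalIntegrable_rpow' (a := t) (b := 0)
              (by linarith : -1 < α - 1)).comp_sub_left t).mul_const _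
          · exact mul_le_mul_of_nonneg_left
              ((strictAntiOn_mittagLefflerKernel_one hα₀ hα₁).antitoneOn hs.1.le ht.le hs.2.le)
              (Real.rpow_nonneg (sub_nonneg.2 hs.2.le) _)
      _ = Real.Gamma α * (1 - mittagLefflerKernel α 1 t) := by
          rw [integral_sub_rpow_mul_mittagLefflerKernel hα₀ hα₁ one_pos hα₀ ht,
            mittagLefflerKernel_eq_sub hα₀ hα₁ one_pos ht]
          simp
      _ ≤ _ := by gcongr; linarith
  have hpt := Real.rpow_pos_of_pos ht α
  rw [Real.rpow_neg ht.le, ← div_eq_mul_inv, le_div_iff₀ hpt]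
  rw [div_mul_eq_mul_div, div_le_iff₀ hα₀] at h
  linarith

/-- Use `(t - s) ^ α ≤ t (t - s) ^ (α - 1)` in the integral of order `1 + α`. The Volterra equation
and two series shifts then give `Γ(α) t v ≤ Γ(1 + α) (1 - g)`. -/
theorem mul_mittagLefflerKernel_self_le {α t : ℝ} (hα₀ : 0 < α) (hα₁ : α < 1) (ht : 0 < t) :
    t * mittagLefflerKernel α α t ≤ α := by
  have hG := Real.Gamma_pos_of_pos hα₀
  have hα' : 0 < 1 + α := by linarith
  have hΓ : Real.Gamma (1 + α) = α * Real.Gamma α := by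
    rw [add_comm, Real.Gamma_add_one hα₀.ne']
  have hI := intervalIntegrable_sub_rpow_mul_mittagLefflerKernel hα₀ hα₁ hα₀ hα' ht
  have h1 : ∫ s in (0 : ℝ)..t, (t - s) ^ (1 + α - 1) * mittagLefflerKernel α α s ≤
      t * ∫ s in (0 : ℝ)..t, (t - s) ^ (α - 1) * mittagLefflerKernel α α s := by
    rw [← intervalIntegral.integral_const_mul]
    refine intervalIntegral.integral_mono_on_of_le_Ioo ht.le hI
      ((intervalIntegrable_sub_rpow_mul_mittagLefflerKernel hα₀ hα₁ hα₀ hα₀ ht).const_mul _)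
      fun s hs => ?_
    have hts : 0 < t - s := sub_pos.2 hs.2
    rw [add_sub_assoc, Real.rpow_add hts, Real.rpow_one, mul_assoc]
    exact mul_le_mul_of_nonneg_right (by linarith [hs.1])
      (mul_nonneg (Real.rpow_nonneg hts.le _) (mittagLefflerKernel_self_pos hα₀ hα₁ hs.1).le)
  rw [integral_sub_rpow_mul_mittagLefflerKernel hα₀ hα₁ hα₀ hα' ht] at h1
  have h2 := Gamma_mul_mittagLefflerKernel_self hα₀ hα₁ ht
  have h3 := mittagLefflerKernel_eq_sub hα₀ hα₁ hα' ht
  have h4 := mittagLefflerKernel_eq_sub hα₀ hα₁ one_pos ht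
  have hf := mittagLefflerKernel_one_pos hα₀ hα₁ ht.le
  have e : α + (1 + α) = 1 + α + α := by ring
  have hta : t * t ^ (α - 1) = t ^ α := by
    nth_rewrite 1 [← Real.rpow_one t]
    rw [← Real.rpow_add ht]; ring_nf
  rw [e] at h1
  rw [add_sub_cancel_left, eq_sub_iff_add_eq, eq_div_iff (by positivity)] at h3
  simp only [sub_self, Real.rpow_zero, Real.Gamma_one, div_one] at h4
  have h5 : Real.Gamma α * (t * mittagLefflerKernel α α t) ≤ Real.Gamma α * α := by
    calc Real.Gamma α * (t * mittagLefflerKernel α α t)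
        = t * (Real.Gamma α * mittagLefflerKernel α α t) := by ring
      _ ≤ Real.Gamma (1 + α) * mittagLefflerKernel α (1 + α) t := by
          rw [h2, mul_sub, hta]; linarith
      _ ≤ Real.Gamma (1 + α) * 1 := by
          gcongr; linarith
      _ = _ := by rw [hΓ]; ring
  exact le_of_mul_le_mul_left h5 hG

theorem tendsto_mittagLefflerKernel_one_atTop {α : ℝ} (hα₀ : 0 < α) (hα₁ : α < 1) :
    Tendsto (mittagLefflerKernel α 1) atTop (𝓝 0) := by
  have h : Tendsto (fun t : ℝ => α * Real.Gamma α * t ^ (-α)) atTop (𝓝 0) := by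
    simpa using (tendsto_rpow_neg_atTop hα₀).const_mul (α * Real.Gamma α)
  refine squeeze_zero' ?_ ?_ h
  · filter_upwards [eventually_ge_atTop 0] with t ht
    exact (mittagLefflerKernel_one_pos hα₀ hα₁ ht).le
  · filter_upwards [eventually_gt_atTop 0] with t ht
    exact mittagLefflerKernel_one_le hα₀ hα₁ ht

theorem eventually_rpow_neg_le_mittagLefflerKernel_one {α : ℝ} (hα₀ : 0 < α) (hα₁ : α < 1) :
    ∀ᶠ t in atTop, t ^ (-α) ≤ 2 * Real.Gamma (1 - α) * mittagLefflerKernel α 1 t := by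
  filter_upwards [eventually_gt_atTop 0,
    (tendsto_mittagLefflerKernel_one_atTop hα₀ hα₁).eventually_lt_const
      (by norm_num : (0 : ℝ) < 1 / 2)] with t ht h
  have h1 := rpow_neg_mul_one_sub_le_mittagLefflerKernel_one hα₀ hα₁ ht
  have h2 : t ^ (-α) * (1 / 2) ≤ t ^ (-α) * (1 - mittagLefflerKernel α 1 t) := by
    gcongr; linarith
  linarith

/-- With `g` at least a multiple of `t ^ (-α)` and `v ≤ α / t`, the ratio dominates a multiple of `t
^ (1 - α)`. -/
theorem tendsto_mittagLefflerKernel_one_div_self_atTop {α : ℝ} (hα₀ : 0 < α) (hα₁ : α < 1) :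
    Tendsto (fun t => mittagLefflerKernel α 1 t / mittagLefflerKernel α α t) atTop atTop := by
  have hG := Real.Gamma_pos_of_pos (sub_pos.2 hα₁)
  have h : Tendsto (fun t : ℝ => (2 * Real.Gamma (1 - α) * α)⁻¹ * t ^ (1 - α)) atTop atTop :=
    (tendsto_rpow_atTop (sub_pos.2 hα₁)).const_mul_atTop (by positivity)
  refine tendsto_atTop_mono' _ ?_ h
  filter_upwards [eventually_gt_atTop 0,
    eventually_rpow_neg_le_mittagLefflerKernel_one hα₀ hα₁] with t ht h1
  have hu := mittagLefflerKernel_self_pos hα₀ hα₁ ht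
  have h2 := mul_mittagLefflerKernel_self_le hα₀ hα₁ ht
  have hp := Real.rpow_pos_of_pos ht (-α)
  have e : t ^ (1 - α) = t * t ^ (-α) := by
    rw [sub_eq_add_neg, Real.rpow_add ht, Real.rpow_one]
  rw [le_div_iff₀ hu, e, mul_assoc, inv_mul_le_iff₀ (by positivity)]
  nlinarith [mul_le_mul_of_nonneg_left h2 hp.le, mul_le_mul_of_nonneg_left h1 hα₀.le]

theorem tendsto_mittagLefflerKernel_one_div_self_zero {α : ℝ} (hα₀ : 0 < α) (hα₁ : α < 1) :
    Tendsto (fun t => mittagLefflerKernel α 1 t / mittagLefflerKernel α α t) (𝓝[>] 0) (𝓝 0) := by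
  have hG := Real.Gamma_pos_of_pos hα₀
  have h1 : Tendsto (fun t : ℝ => t ^ (1 - α) * mittagLefflerKernel α 1 t) (𝓝[>] 0) (𝓝 0) := by
    have hc : Continuous fun t : ℝ => t ^ (1 - α) * mittagLefflerKernel α 1 t :=
      (Real.continuous_rpow_const (sub_nonneg.2 hα₁.le)).mul
        (continuous_mittagLefflerKernel_one hα₀ hα₁)
    have := (hc.tendsto 0).mono_left (nhdsWithin_le_nhds (s := Ioi 0))
    simpa [Real.zero_rpow (sub_pos.2 hα₁).ne'] using this
  have h := h1.div (tendsto_rpow_mul_mittagLefflerKernel hα₀ hα₁ hα₀) (inv_pos.2 hG).ne'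
  rw [zero_div] at h
  refine h.congr' ?_
  filter_upwards [self_mem_nhdsWithin] with t ht
  exact mul_div_mul_left _ _ (Real.rpow_pos_of_pos ht _).ne'

theorem integrableOn_sq_mittagLefflerKernel_one_iff {α : ℝ} (hα₀ : 0 < α) (hα₁ : α < 1) :
    IntegrableOn (fun t => mittagLefflerKernel α 1 t ^ 2) (Ioi 0) ↔ 1 / 2 < α := by
  have hG := Real.Gamma_pos_of_pos (sub_pos.2 hα₁)
  have hc : Continuous fun t => mittagLefflerKernel α 1 t ^ 2 :=
    (continuous_mittagLefflerKernel_one hα₀ hα₁).pow 2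
  have hsq : ∀ t : ℝ, 0 < t → (t ^ (-α)) ^ 2 = t ^ (-(2 * α)) := fun t ht => by
    rw [← Real.rpow_mul_natCast ht.le]; congr 1; push_cast; ring
  constructor
  · intro h
    obtain ⟨A, hA⟩ := eventually_atTop.1 (eventually_rpow_neg_le_mittagLefflerKernel_one hα₀ hα₁)
    have hB : 0 < max A 1 := by positivity
    have h1 : IntegrableOn (fun t : ℝ => t ^ (-(2 * α))) (Ioi (max A 1)) := by
      refine Integrable.mono' ((h.mono_set (Ioi_subset_Ioi hB.le)).const_mul
        ((2 * Real.Gamma (1 - α)) ^ 2)) (by fun_prop) ?_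
      filter_upwards [ae_restrict_mem measurableSet_Ioi] with t ht
      have ht0 : 0 < t := hB.trans ht
      rw [Real.norm_of_nonneg (Real.rpow_nonneg ht0.le _), ← hsq t ht0, ← mul_pow]
      have := hA t ((le_max_left A 1).trans (le_of_lt ht))
      have := Real.rpow_nonneg ht0.le (-α)
      gcongr
    have := (integrableOn_Ioi_rpow_iff hB).1 h1
    linarith
  · intro h
    rw [← Ioc_union_Ioi_eq_Ioi (zero_le_one' ℝ)]
    refine (hc.integrableOn_Ioc).union ?_
    refine Integrable.mono' (((integrableOn_Ioi_rpow_iff one_pos).2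
      (by linarith : -(2 * α) < -1)).const_mul ((α * Real.Gamma α) ^ 2))
      hc.aestronglyMeasurable ?_
    filter_upwards [ae_restrict_mem measurableSet_Ioi] with t ht
    have ht0 : 0 < t := one_pos.trans ht
    have := (mittagLefflerKernel_one_pos hα₀ hα₁ ht0.le).le
    rw [Real.norm_of_nonneg (by positivity), ← hsq t ht0, ← mul_pow]
    gcongr
    exact mittagLefflerKernel_one_le hα₀ hα₁ ht0

/-! ### Relaxation profiles, their energy and the nonlinear equation. -/

/-- `g` decreases from `1` to `0` on `[0, ∞)` with derivative `-v`, and the ratio `g / v` runs from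
`0` to `∞`. -/
structure IsRelaxationProfile (g v : ℝ → ℝ) : Prop where
  continuous : Continuous g
  zero : g 0 = 1
  hasDerivAt : ∀ t, 0 < t → HasDerivAt g (-v t) t
  rate_pos : ∀ t, 0 < t → 0 < v t
  rate_continuousOn : ContinuousOn v (Ioi 0)
  tendsto_atTop : Tendsto g atTop (𝓝 0)
  tendsto_ratio_atTop : Tendsto (fun t => g t / v t) atTop atTop
  tendsto_ratio_zero : Tendsto (fun t => g t / v t) (𝓝[>] 0) (𝓝 0)

/-- The time at which the profile `k₀ g` takes a given value. -/
noncomputable def profileTime (k₀ : ℝ) (g : ℝ → ℝ) (σ : ℝ) : ℝ :=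
  Function.invFunOn (fun s => k₀ * g s) (Ici 0) σ

namespace IsRelaxationProfile

variable {g v : ℝ → ℝ} {k₀ : ℝ}

theorem strictAntiOn (h : IsRelaxationProfile g v) : StrictAntiOn g (Ici 0) := by
  refine strictAntiOn_of_deriv_neg (convex_Ici 0) h.continuous.continuousOn fun t ht => ?_
  rw [interior_Ici] at ht
  rw [(h.hasDerivAt t ht).deriv]
  exact neg_neg_of_pos (h.rate_pos t ht)

theorem pos (h : IsRelaxationProfile g v) {t : ℝ} (ht : 0 ≤ t) : 0 < g t := by
  have h1 : g (t + 1) < g t :=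
    h.strictAntiOn ht (by simp only [mem_Ici]; linarith) (by linarith)
  refine lt_of_le_of_lt (le_of_tendsto h.tendsto_atTop ?_) h1
  filter_upwards [eventually_ge_atTop (t + 1)] with s hs
  exact h.strictAntiOn.antitoneOn (by simp only [mem_Ici]; linarith)
    (by simp only [mem_Ici]; linarith) hs

theorem le_one (h : IsRelaxationProfile g v) {t : ℝ} (ht : 0 ≤ t) : g t ≤ 1 := by
  rw [← h.zero]
  exact h.strictAntiOn.antitoneOn self_mem_Ici ht ht

theorem lt_one (h : IsRelaxationProfile g v) {t : ℝ} (ht : 0 < t) : g t < 1 := by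
  rw [← h.zero]
  exact h.strictAntiOn self_mem_Ici ht.le ht

theorem bijOn (h : IsRelaxationProfile g v) (hk₀ : 0 < k₀) :
    BijOn (fun s => k₀ * g s) (Ici 0) (Ioc 0 k₀) := by
  refine ⟨fun s hs => ⟨mul_pos hk₀ (h.pos hs), ?_⟩, fun s hs t ht hst =>
    h.strictAntiOn.injOn hs ht (mul_left_cancel₀ hk₀.ne' hst), fun σ hσ => ?_⟩
  · simpa using mul_le_mul_of_nonneg_left (h.le_one hs) hk₀.le
  · have hlt : 0 < σ / k₀ := div_pos hσ.1 hk₀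
    obtain ⟨T, hT, hT0⟩ := ((h.tendsto_atTop.eventually_lt_const hlt).and
      (eventually_ge_atTop 0)).exists
    obtain ⟨s, hs, hgs⟩ := intermediate_value_Icc' hT0 h.continuous.continuousOn
      ⟨hT.le, by rw [h.zero]; exact (div_le_one hk₀).2 hσ.2⟩
    refine ⟨s, hs.1, ?_⟩
    simp only [hgs]
    field_simp

theorem profileTime_nonneg (h : IsRelaxationProfile g v) (hk₀ : 0 < k₀) {σ : ℝ}
    (hσ : σ ∈ Ioc 0 k₀) : 0 ≤ profileTime k₀ g σ :=
  Function.invFunOn_mem ((h.bijOn hk₀).surjOn hσ)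

theorem apply_profileTime (h : IsRelaxationProfile g v) (hk₀ : 0 < k₀) {σ : ℝ}
    (hσ : σ ∈ Ioc 0 k₀) : k₀ * g (profileTime k₀ g σ) = σ :=
  Function.invFunOn_eq ((h.bijOn hk₀).surjOn hσ)

theorem profileTime_apply (h : IsRelaxationProfile g v) (hk₀ : 0 < k₀) {s : ℝ} (hs : 0 ≤ s) :
    profileTime k₀ g (k₀ * g s) = s :=
  (h.bijOn hk₀).injOn (h.profileTime_nonneg hk₀ ((h.bijOn hk₀).mapsTo hs)) hs
    (h.apply_profileTime hk₀ ((h.bijOn hk₀).mapsTo hs))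

theorem profileTime_pos (h : IsRelaxationProfile g v) (hk₀ : 0 < k₀) {σ : ℝ}
    (hσ : σ ∈ Ioo 0 k₀) : 0 < profileTime k₀ g σ := by
  refine (h.profileTime_nonneg hk₀ (Ioo_subset_Ioc_self hσ)).lt_of_ne fun h0 => hσ.2.ne ?_
  rw [← h.apply_profileTime hk₀ (Ioo_subset_Ioc_self hσ), ← h0, h.zero, mul_one]

theorem lt_profileTime (h : IsRelaxationProfile g v) (hk₀ : 0 < k₀) {σ s : ℝ}
    (hσ : σ ∈ Ioc 0 k₀) (hs : 0 ≤ s) (hlt : σ < k₀ * g s) : s < profileTime k₀ g σ := by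
  by_contra! hle
  have := h.strictAntiOn.antitoneOn (h.profileTime_nonneg hk₀ hσ) hs hle
  rw [← h.apply_profileTime hk₀ hσ] at hlt
  exact (mul_le_mul_of_nonneg_left this hk₀.le).not_gt hlt

theorem profileTime_lt (h : IsRelaxationProfile g v) (hk₀ : 0 < k₀) {σ s : ℝ}
    (hσ : σ ∈ Ioc 0 k₀) (hs : 0 ≤ s) (hlt : k₀ * g s < σ) : profileTime k₀ g σ < s := by
  by_contra! hle
  have := h.strictAntiOn.antitoneOn hs (h.profileTime_nonneg hk₀ hσ) hle
  rw [← h.apply_profileTime hk₀ hσ] at hlt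
  exact (mul_le_mul_of_nonneg_left this hk₀.le).not_gt hlt

theorem tendsto_profileTime_zero (h : IsRelaxationProfile g v) (hk₀ : 0 < k₀) :
    Tendsto (profileTime k₀ g) (𝓝[>] 0) atTop := by
  refine Filter.tendsto_atTop.2 fun M => ?_
  have hM : 0 < k₀ * g (max M 0) := mul_pos hk₀ (h.pos (le_max_right _ _))
  filter_upwards [Ioo_mem_nhdsGT hM, Ioc_mem_nhdsGT hk₀] with σ h1 h2
  exact (le_max_left M 0).trans (h.lt_profileTime hk₀ h2 (le_max_right _ _) h1.2).le

theorem tendsto_profileTime_left (h : IsRelaxationProfile g v) (hk₀ : 0 < k₀) :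
    Tendsto (profileTime k₀ g) (𝓝[<] k₀) (𝓝[>] 0) := by
  refine (nhdsGT_basis (0 : ℝ)).tendsto_right_iff.2 fun δ hδ => ?_
  have h1 : k₀ * g δ < k₀ := by simpa using mul_lt_mul_of_pos_left (h.lt_one hδ) hk₀
  filter_upwards [Ioo_mem_nhdsLT h1, Ioo_mem_nhdsLT hk₀] with σ h2 h3
  exact ⟨h.profileTime_pos hk₀ h3, h.profileTime_lt hk₀ (Ioo_subset_Ioc_self h3) hδ.le h2.1⟩

theorem continuousAt_profileTime (h : IsRelaxationProfile g v) (hk₀ : 0 < k₀) {σ : ℝ}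
    (hσ : σ ∈ Ioo 0 k₀) : ContinuousAt (profileTime k₀ g) σ := by
  have hσ' := Ioo_subset_Ioc_self hσ
  have hp := h.profileTime_pos hk₀ hσ
  have he := h.apply_profileTime hk₀ hσ'
  refine tendsto_order.2 ⟨fun a ha => ?_, fun b hb => ?_⟩
  · have hm : max a 0 < profileTime k₀ g σ := max_lt ha hp
    have h1 : σ < k₀ * g (max a 0) := by
      rw [← he]
      exact mul_lt_mul_of_pos_left (h.strictAntiOn (mem_Ici.2 (le_max_right _ _)) hp.le hm) hk₀
    filter_upwards [Iio_mem_nhds h1, Ioo_mem_nhds hσ.1 hσ.2] with y hy hy'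
    exact (le_max_left a 0).trans_lt
      (h.lt_profileTime hk₀ (Ioo_subset_Ioc_self hy') (le_max_right _ _) hy)
  · have h1 : k₀ * g b < σ := by
      rw [← he]
      exact mul_lt_mul_of_pos_left (h.strictAntiOn hp.le (hp.trans hb).le hb) hk₀
    filter_upwards [Ioi_mem_nhds h1, Ioo_mem_nhds hσ.1 hσ.2] with y hy hy'
    exact h.profileTime_lt hk₀ (Ioo_subset_Ioc_self hy') (hp.trans hb).le hy

theorem hasDerivAt_profileTime (h : IsRelaxationProfile g v) (hk₀ : 0 < k₀) {σ : ℝ}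
    (hσ : σ ∈ Ioo 0 k₀) :
    HasDerivAt (profileTime k₀ g) (k₀ * -v (profileTime k₀ g σ))⁻¹ σ := by
  have hp := h.profileTime_pos hk₀ hσ
  refine HasDerivAt.of_local_left_inverse (h.continuousAt_profileTime hk₀ hσ)
    ((h.hasDerivAt _ hp).const_mul k₀)
    (mul_ne_zero hk₀.ne' (neg_ne_zero.2 (h.rate_pos _ hp).ne')) ?_
  filter_upwards [Ioo_mem_nhds hσ.1 hσ.2] with y hy
  exact h.apply_profileTime hk₀ (Ioo_subset_Ioc_self hy)

variable {eV : ℝ → ℝ} {c e₀ : ℝ}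

theorem energy_eq (h : IsRelaxationProfile g v) (hk₀ : 0 < k₀)
    (hE : ∀ s, 0 ≤ s → eV (k₀ * g s) = e₀ - c * ∫ r in (0 : ℝ)..s, g r ^ 2)
    {σ : ℝ} (hσ : σ ∈ Ioc 0 k₀) :
    eV σ = e₀ - c * ∫ r in (0 : ℝ)..profileTime k₀ g σ, g r ^ 2 := by
  rw [← hE _ (h.profileTime_nonneg hk₀ hσ), h.apply_profileTime hk₀ hσ]

theorem hasDerivAt_integral (h : IsRelaxationProfile g v) (s : ℝ) :
    HasDerivAt (fun s => e₀ - c * ∫ r in (0 : ℝ)..s, g r ^ 2) (-(c * g s ^ 2)) s := by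
  have hc : Continuous fun r => g r ^ 2 := h.continuous.pow 2
  exact ((intervalIntegral.integral_hasDerivAt_right (hc.intervalIntegrable _ _)
    (hc.stronglyMeasurableAtFilter _ _) hc.continuousAt).const_mul c).const_sub e₀

/-- Quotient of the parametric derivatives `-c g²` and `-k₀ v`, grouped as `g (g / v)` so that the
limits of the ratio apply directly. -/
theorem hasDerivAt_energy (h : IsRelaxationProfile g v) (hk₀ : 0 < k₀)
    (hE : ∀ s, 0 ≤ s → eV (k₀ * g s) = e₀ - c * ∫ r in (0 : ℝ)..s, g r ^ 2)
    {σ : ℝ} (hσ : σ ∈ Ioo 0 k₀) :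
    HasDerivAt eV (c / k₀ * (g (profileTime k₀ g σ) *
      (g (profileTime k₀ g σ) / v (profileTime k₀ g σ)))) σ := by
  have hv := h.rate_pos _ (h.profileTime_pos hk₀ hσ)
  have h1 := (h.hasDerivAt_integral (e₀ := e₀) (c := c) (profileTime k₀ g σ)).comp σ
    (h.hasDerivAt_profileTime hk₀ hσ)
  refine (h1.congr_of_eventuallyEq ?_).congr_deriv ?_
  · filter_upwards [Ioo_mem_nhds hσ.1 hσ.2] with y hy
    exact h.energy_eq hk₀ hE (Ioo_subset_Ioc_self hy)
  · field_simp

/-- The stress `k₀` corresponds to `s = 0`, where `g` need not be differentiable, so the left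
derivative is obtained as the limit of the interior derivatives. -/
theorem hasDerivWithinAt_energy_right (h : IsRelaxationProfile g v) (hk₀ : 0 < k₀)
    (hE : ∀ s, 0 ≤ s → eV (k₀ * g s) = e₀ - c * ∫ r in (0 : ℝ)..s, g r ^ 2) :
    HasDerivWithinAt eV 0 (Iic k₀) k₀ := by
  refine hasDerivWithinAt_Iic_of_tendsto_deriv (s := Ioo 0 k₀)
    (fun σ hσ => (h.hasDerivAt_energy hk₀ hE hσ).differentiableAt.differentiableWithinAt) ?_
    (Ioo_mem_nhdsLT hk₀) ?_
  · have h1 := ((h.hasDerivAt_integral (e₀ := e₀) (c := c) 0).continuousAt.tendsto).comp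
      ((h.tendsto_profileTime_left hk₀).mono_right nhdsWithin_le_nhds)
    have h2 := hE 0 le_rfl
    rw [h.zero, mul_one] at h2
    rw [← h2] at h1
    refine (h1.mono_left (nhdsWithin_mono _ fun x hx => hx.2)).congr' ?_
    filter_upwards [self_mem_nhdsWithin] with y hy
    exact (h.energy_eq hk₀ hE (Ioo_subset_Ioc_self hy)).symm
  · have h1 : Tendsto (fun s => c / k₀ * (g s * (g s / v s))) (𝓝[>] 0) (𝓝 0) := by
      have := (((h.continuous.tendsto 0).mono_left (nhdsWithin_le_nhds (s := Ioi 0))).mul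
        h.tendsto_ratio_zero).const_mul (c / k₀)
      simpa using this
    refine (h1.comp (h.tendsto_profileTime_left hk₀)).congr' ?_
    filter_upwards [Ioo_mem_nhdsLT hk₀] with y hy
    exact (h.hasDerivAt_energy hk₀ hE hy).deriv.symm

theorem differentiableOn_energy (h : IsRelaxationProfile g v) (hk₀ : 0 < k₀)
    (hE : ∀ s, 0 ≤ s → eV (k₀ * g s) = e₀ - c * ∫ r in (0 : ℝ)..s, g r ^ 2) :
    DifferentiableOn ℝ eV (Ioc 0 k₀) := by
  intro σ hσ
  rcases hσ.2.eq_or_lt with rfl | hlt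
  · exact ((h.hasDerivWithinAt_energy_right hk₀ hE).mono fun x hx => hx.2).differentiableWithinAt
  · exact (h.hasDerivAt_energy hk₀ hE ⟨hσ.1, hlt⟩).differentiableAt.differentiableWithinAt

variable {ρ ε₀ : ℝ} {μ : ℝ → ℝ}

theorem relaxationTime_right (h : IsRelaxationProfile g v) (hk₀ : 0 < k₀)
    (hE : ∀ s, 0 ≤ s → eV (k₀ * g s) = e₀ - c * ∫ r in (0 : ℝ)..s, g r ^ 2) :
    relaxationTime ρ μ k₀ eV ε₀ k₀ = 0 := by
  have h1 := (h.hasDerivWithinAt_energy_right hk₀ hE).mono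
    (fun x hx => hx.2 : Ioc 0 k₀ ⊆ Iic k₀)
  rw [relaxationTime, h1.derivWithin (uniqueDiffOn_Ioc 0 k₀ _ ⟨hk₀, le_rfl⟩)]
  simp

theorem relaxationTime_eq (h : IsRelaxationProfile g v) (hk₀ : 0 < k₀) (hρ : 0 < ρ)
    (hμ : 0 < μ ε₀)
    (hE : ∀ s, 0 ≤ s →
      eV (k₀ * g s) = e₀ - k₀ ^ 2 / (ρ * μ ε₀) * ∫ r in (0 : ℝ)..s, g r ^ 2)
    {σ : ℝ} (hσ : σ ∈ Ioo 0 k₀) :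
    relaxationTime ρ μ k₀ eV ε₀ σ = g (profileTime k₀ g σ) / v (profileTime k₀ g σ) := by
  have hσ' := Ioo_subset_Ioc_self hσ
  have hp := h.profileTime_pos hk₀ hσ
  have hg := h.pos hp.le
  have hv := h.rate_pos _ hp
  rw [relaxationTime, (h.hasDerivAt_energy hk₀ hE hσ).hasDerivWithinAt.derivWithin
    (uniqueDiffOn_Ioc 0 k₀ _ hσ')]
  -- The fourth occurrence is the denominator `σ`; once written as `k₀ g` it cancels one factor `g`
  -- and the constants.
  nth_rewrite 4 [← h.apply_profileTime hk₀ hσ']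
  field_simp

theorem relaxationTime_pos (h : IsRelaxationProfile g v) (hk₀ : 0 < k₀) (hρ : 0 < ρ)
    (hμ : 0 < μ ε₀)
    (hE : ∀ s, 0 ≤ s →
      eV (k₀ * g s) = e₀ - k₀ ^ 2 / (ρ * μ ε₀) * ∫ r in (0 : ℝ)..s, g r ^ 2)
    {σ : ℝ} (hσ : σ ∈ Ioo 0 k₀) : 0 < relaxationTime ρ μ k₀ eV ε₀ σ := by
  have hp := h.profileTime_pos hk₀ hσ
  rw [h.relaxationTime_eq hk₀ hρ hμ hE hσ]
  exact div_pos (h.pos hp.le) (h.rate_pos _ hp)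

theorem tendsto_relaxationTime_zero (h : IsRelaxationProfile g v) (hk₀ : 0 < k₀) (hρ : 0 < ρ)
    (hμ : 0 < μ ε₀)
    (hE : ∀ s, 0 ≤ s →
      eV (k₀ * g s) = e₀ - k₀ ^ 2 / (ρ * μ ε₀) * ∫ r in (0 : ℝ)..s, g r ^ 2) :
    Tendsto (relaxationTime ρ μ k₀ eV ε₀) (𝓝[>] 0) atTop := by
  refine (h.tendsto_ratio_atTop.comp (h.tendsto_profileTime_zero hk₀)).congr' ?_
  filter_upwards [Ioo_mem_nhdsGT hk₀] with σ hσ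
  exact (h.relaxationTime_eq hk₀ hρ hμ hE hσ).symm

theorem tendsto_relaxationTime_right (h : IsRelaxationProfile g v) (hk₀ : 0 < k₀) (hρ : 0 < ρ)
    (hμ : 0 < μ ε₀)
    (hE : ∀ s, 0 ≤ s →
      eV (k₀ * g s) = e₀ - k₀ ^ 2 / (ρ * μ ε₀) * ∫ r in (0 : ℝ)..s, g r ^ 2) :
    Tendsto (relaxationTime ρ μ k₀ eV ε₀) (𝓝[<] k₀) (𝓝 0) := by
  refine (h.tendsto_ratio_zero.comp (h.tendsto_profileTime_left hk₀)).congr' ?_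
  filter_upwards [Ioo_mem_nhdsLT hk₀] with σ hσ
  exact (h.relaxationTime_eq hk₀ hρ hμ hE hσ).symm

theorem isNonlinearRelaxation (h : IsRelaxationProfile g v) (hk₀ : 0 < k₀) (hρ : 0 < ρ)
    (hμ : 0 < μ ε₀)
    (hE : ∀ s, 0 ≤ s →
      eV (k₀ * g s) = e₀ - k₀ ^ 2 / (ρ * μ ε₀) * ∫ r in (0 : ℝ)..s, g r ^ 2) :
    IsNonlinearRelaxation ρ μ k₀ eV ε₀ (fun t => k₀ * g t) where
  continuousOn := (h.continuous.const_mul k₀).continuousOn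
  mem_domain t ht := (h.bijOn hk₀).mapsTo ht
  differentiableAt t ht := ((h.hasDerivAt t ht).const_mul k₀).differentiableAt
  equation t ht := by
    have hσ : k₀ * g t ∈ Ioo 0 k₀ := ⟨mul_pos hk₀ (h.pos ht.le), by
      simpa using mul_lt_mul_of_pos_left (h.lt_one ht) hk₀⟩
    have h1 := h.relaxationTime_eq hk₀ hρ hμ hE hσ
    rw [h.profileTime_apply hk₀ ht.le, relaxationTime] at h1
    have hv := h.rate_pos t ht
    rw [h1, ((h.hasDerivAt t ht).const_mul k₀).deriv]
    field_simp
    ring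

/-- Every solution of the nonlinear relaxation equation is a translate of the profile. -/
theorem exists_eq_shift (h : IsRelaxationProfile g v) (hk₀ : 0 < k₀) (hρ : 0 < ρ)
    (hμ : 0 < μ ε₀)
    (hE : ∀ s, 0 ≤ s →
      eV (k₀ * g s) = e₀ - k₀ ^ 2 / (ρ * μ ε₀) * ∫ r in (0 : ℝ)..s, g r ^ 2)
    {σ : ℝ → ℝ} (hσ : IsNonlinearRelaxation ρ μ k₀ eV ε₀ σ) :
    ∃ d, 0 ≤ d ∧ ∀ t, 0 ≤ t → σ t = k₀ * g (t + d) := by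
  have heq : ∀ t, 0 < t → σ t + relaxationTime ρ μ k₀ eV ε₀ (σ t) * deriv σ t = 0 := hσ.equation
  -- The value `k₀` is not attained at positive times: the relaxation time vanishes there and the
  -- equation would read `k₀ = 0`.
  have hmem : ∀ t, 0 < t → σ t ∈ Ioo 0 k₀ := fun t ht => by
    have hm := hσ.mem_domain t ht.le
    refine ⟨hm.1, hm.2.lt_of_ne fun he => ?_⟩
    have h1 := heq t ht
    rw [he, h.relaxationTime_right hk₀ hE] at h1
    linarith
  -- In the coordinate `profileTime`, every solution moves at unit speed, so no uniqueness theorem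
  -- is needed for the equation, which degenerates at `k₀`.
  have hd : ∀ t, 0 < t → HasDerivAt (fun t => profileTime k₀ g (σ t) - t) 0 t := fun t ht => by
    have h1 := ((h.hasDerivAt_profileTime hk₀ (hmem t ht)).comp t
      (hσ.differentiableAt t ht).hasDerivAt).sub (hasDerivAt_id t)
    refine h1.congr_deriv ?_
    have hp := h.profileTime_pos hk₀ (hmem t ht)
    have hv := h.rate_pos _ hp
    have hg := h.pos hp.le
    have h2 := heq t ht
    rw [h.relaxationTime_eq hk₀ hρ hμ hE (hmem t ht)] at h2
    nth_rewrite 1 [← h.apply_profileTime hk₀ (Ioo_subset_Ioc_self (hmem t ht))] at h2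
    have h3 : deriv σ t = k₀ * -v (profileTime k₀ g (σ t)) := by
      field_simp at h2
      rw [mul_zero] at h2
      linarith [(mul_eq_zero.1 h2).resolve_left hg.ne']
    rw [h3, inv_mul_cancel₀ (mul_ne_zero hk₀.ne' (neg_ne_zero.2 hv.ne')), sub_self]
  obtain ⟨d, hd'⟩ := isOpen_Ioi.exists_is_const_of_deriv_eq_zero (convex_Ioi (0 : ℝ)).isPreconnected
    (fun t ht => (hd t ht).differentiableAt.differentiableWithinAt) (fun t ht => (hd t ht).deriv)
  have hpd : ∀ t, 0 < t → profileTime k₀ g (σ t) = t + d := fun t ht => by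
    linarith [hd' t ht]
  have hshift : ∀ t, 0 < t → σ t = k₀ * g (t + d) := fun t ht => by
    rw [← hpd t ht, h.apply_profileTime hk₀ (Ioo_subset_Ioc_self (hmem t ht))]
  refine ⟨d, ?_, fun t ht => ?_⟩
  · refine le_of_forall_pos_le_add fun t ht => ?_
    have := h.profileTime_pos hk₀ (hmem t ht)
    rw [hpd t ht] at this
    linarith
  · rcases ht.eq_or_lt with rfl | ht
    · have h1 : Tendsto σ (𝓝[>] 0) (𝓝 (σ 0)) :=
        (hσ.continuousOn 0 self_mem_Ici).mono_left (nhdsWithin_mono _ Ioi_subset_Ici_self)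
      have hc : Continuous fun t => k₀ * g (t + d) :=
        (h.continuous.comp (continuous_add_const d)).const_mul k₀
      refine tendsto_nhds_unique h1 (((hc.tendsto 0).mono_left nhdsWithin_le_nhds).congr' ?_)
      filter_upwards [self_mem_nhdsWithin] with s hs
      exact (hshift s hs).symm
    · exact hshift t ht

theorem exists_energy (h : IsRelaxationProfile g v) (hk₀ : 0 < k₀) (G : ℝ → ℝ) :
    ∃ eV : ℝ → ℝ, ∀ s, 0 ≤ s → eV (k₀ * g s) = G s :=
  ⟨fun σ => G (profileTime k₀ g σ), fun s hs => by simp only [h.profileTime_apply hk₀ hs]⟩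

theorem bounded_energy_iff (h : IsRelaxationProfile g v) (hk₀ : 0 < k₀) (hc : 0 < c)
    (hE : ∀ s, 0 ≤ s → eV (k₀ * g s) = e₀ - c * ∫ r in (0 : ℝ)..s, g r ^ 2) :
    (∃ C : ℝ, ∀ σ ∈ Icc 0 k₀, |eV σ| ≤ C) ↔ IntegrableOn (fun r => g r ^ 2) (Ioi 0) := by
  have hcont : Continuous fun r => g r ^ 2 := h.continuous.pow 2
  constructor
  · rintro ⟨C, hC⟩
    refine integrableOn_Ioi_of_intervalIntegral_norm_bounded (l := atTop) (b := id)
      ((e₀ + C) / c) 0 (fun i => hcont.integrableOn_Ioc) tendsto_id ?_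
    filter_upwards [eventually_ge_atTop 0] with s hs
    have h1 := hC _ (Ioc_subset_Icc_self ((h.bijOn hk₀).mapsTo hs))
    simp only [hE s hs] at h1
    simp only [norm_pow, Real.norm_eq_abs, sq_abs, id]
    rw [le_div_iff₀ hc]
    linarith [(abs_le.1 h1).1]
  · intro hint
    -- The parametrization does not prescribe `eV 0`, so it enters the bound separately.
    refine ⟨max |eV 0| (|e₀| + c * ∫ r in Ioi 0, g r ^ 2), fun σ hσ => ?_⟩
    rcases hσ.1.eq_or_lt with rfl | hpos
    · exact le_max_left _ _
    · refine le_max_of_le_right ?_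
      have hσ' : σ ∈ Ioc 0 k₀ := ⟨hpos, hσ.2⟩
      have hp := h.profileTime_nonneg hk₀ hσ'
      have h0 : 0 ≤ ∫ r in (0 : ℝ)..profileTime k₀ g σ, g r ^ 2 :=
        intervalIntegral.integral_nonneg hp fun r _ => sq_nonneg _
      have h1 : ∫ r in (0 : ℝ)..profileTime k₀ g σ, g r ^ 2 ≤ ∫ r in Ioi 0, g r ^ 2 := by
        rw [intervalIntegral.integral_of_le hp]
        exact setIntegral_mono_set hint (Eventually.of_forall fun r => sq_nonneg _)
          (Eventually.of_forall fun r hr => hr.1)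
      rw [h.energy_eq hk₀ hE hσ']
      refine (abs_sub _ _).trans ?_
      rw [abs_of_nonneg (mul_nonneg hc.le h0)]
      gcongr

theorem tendsto_energy_zero (h : IsRelaxationProfile g v) (hk₀ : 0 < k₀)
    (hE : ∀ s, 0 ≤ s → eV (k₀ * g s) = e₀ - c * ∫ r in (0 : ℝ)..s, g r ^ 2)
    (hint : IntegrableOn (fun r => g r ^ 2) (Ioi 0)) :
    Tendsto eV (𝓝[>] 0) (𝓝 (e₀ - c * ∫ r in Ioi 0, g r ^ 2)) := by
  have h1 := ((intervalIntegral_tendsto_integral_Ioi 0 hint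
    (h.tendsto_profileTime_zero hk₀)).const_mul c).const_sub e₀
  refine h1.congr' ?_
  filter_upwards [Ioc_mem_nhdsGT hk₀] with σ hσ
  exact (h.energy_eq hk₀ hE hσ).symm

end IsRelaxationProfile

/-! ### Absolute continuity and the fractional equation near time zero. -/

theorem AbsolutelyContinuousOnInterval.congr {f g : ℝ → ℝ} {a b : ℝ}
    (hf : AbsolutelyContinuousOnInterval f a b) (hfg : EqOn f g (uIcc a b)) :
    AbsolutelyContinuousOnInterval g a b := by
  refine Tendsto.congr' ?_ hf
  filter_upwards [mem_inf_of_right (mem_principal_self _)] with E hE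
  refine Finset.sum_congr rfl fun i hi => ?_
  rw [hfg (hE.1 i hi).1, hfg (hE.1 i hi).2]

theorem AbsolutelyContinuousOnInterval.const_add {f : ℝ → ℝ} {a b : ℝ} (c : ℝ)
    (hf : AbsolutelyContinuousOnInterval f a b) :
    AbsolutelyContinuousOnInterval (fun x => c + f x) a b := by
  simpa [AbsolutelyContinuousOnInterval] using hf

/-- The Caputo derivative of a function with derivative bounded near `0` vanishes at `0`. -/
theorem tendsto_caputoDeriv_zero {α M : ℝ} (hα₁ : α < 1) {f : ℝ → ℝ}
    (hf : ∀ s ∈ Ioc (0 : ℝ) 1, |deriv f s| ≤ M) :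
    Tendsto (caputoDeriv α f) (𝓝[>] 0) (𝓝 0) := by
  have hβ : 0 < 1 - α := sub_pos.2 hα₁
  have hG := Real.Gamma_pos_of_pos hβ
  have h0 : Tendsto (fun t : ℝ => (Real.Gamma (1 - α))⁻¹ * (t ^ (1 - α) / (1 - α) * M))
      (𝓝[>] 0) (𝓝 0) := by
    have hc : Continuous fun t : ℝ => (Real.Gamma (1 - α))⁻¹ * (t ^ (1 - α) / (1 - α) * M) :=
      (((Real.continuous_rpow_const hβ.le).div_const _).mul_const M).const_mul _
    have := (hc.tendsto 0).mono_left (nhdsWithin_le_nhds (s := Ioi 0))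
    simpa [Real.zero_rpow hβ.ne'] using this
  refine squeeze_zero_norm' ?_ h0
  filter_upwards [Ioc_mem_nhdsGT one_pos] with t ht
  rw [caputoDeriv, norm_mul, Real.norm_of_nonneg (inv_nonneg.2 hG.le)]
  gcongr
  have h1 := integral_sub_rpow (s := 0) (t := t) hβ
  have e : 1 - α - 1 = -α := by ring
  rw [sub_zero, e] at h1
  rw [← h1, ← intervalIntegral.integral_mul_const]
  refine intervalIntegral.norm_integral_le_of_norm_le ht.1.le
    (Eventually.of_forall fun s hs => ?_) ?_
  · have h2 : 0 ≤ (t - s) ^ (-α) := Real.rpow_nonneg (sub_nonneg.2 hs.2) _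
    rw [norm_mul, Real.norm_of_nonneg h2]
    exact mul_le_mul_of_nonneg_left (hf s ⟨hs.1, hs.2.trans ht.2⟩) h2
  · simpa using ((intervalIntegral.intervalIntegrable_rpow' (a := t) (b := 0)
      (by linarith : -1 < -α)).comp_sub_left t).mul_const M

/-- Let `t → 0⁺` in `σ = -τ₀ ^ α D^α σ`. A nonzero initial value therefore requires an unbounded
derivative near `0`, which rules out proper translates of the profile. -/
theorem IsFractionalMaxwellRelaxation.apply_zero_of_bounded_deriv {α τ₀ M : ℝ} (hα₁ : α < 1)
    {σ : ℝ → ℝ} (hσ : IsFractionalMaxwellRelaxation α τ₀ σ) (hc : ContinuousWithinAt σ (Ioi 0) 0)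
    (hM : ∀ s ∈ Ioc (0 : ℝ) 1, |deriv σ s| ≤ M) : σ 0 = 0 := by
  have h1 := (tendsto_caputoDeriv_zero hα₁ hM).const_mul (-τ₀ ^ α)
  rw [mul_zero] at h1
  refine tendsto_nhds_unique hc (h1.congr' ?_)
  filter_upwards [self_mem_nhdsWithin] with t ht
  linarith [hσ.equation t ht]

/-! ### Rescaling by `τ₀` and the final assembly. -/

theorem isRelaxationProfile_mittagLeffler {α τ₀ : ℝ} (hα₀ : 0 < α) (hα₁ : α < 1) (hτ₀ : 0 < τ₀) :
    IsRelaxationProfile (fun s => mittagLefflerKernel α 1 (s / τ₀))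
      (fun s => mittagLefflerKernel α α (s / τ₀) / τ₀) where
  continuous := (continuous_mittagLefflerKernel_one hα₀ hα₁).comp (continuous_id.div_const τ₀)
  zero := by simp [mittagLefflerKernel_one_zero hα₀]
  hasDerivAt t ht := by
    have h := (hasDerivAt_mittagLefflerKernel_one hα₀ hα₁ (div_pos ht hτ₀)).comp t
      ((hasDerivAt_id t).div_const τ₀)
    exact h.congr_deriv (by ring)
  rate_pos t ht := div_pos (mittagLefflerKernel_self_pos hα₀ hα₁ (div_pos ht hτ₀)) hτ₀
  rate_continuousOn := ((continuousOn_mittagLefflerKernel hα₀ hα₁ hα₀).comp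
    (continuous_id.div_const τ₀).continuousOn fun t ht => div_pos ht hτ₀).div_const τ₀
  tendsto_atTop := (tendsto_mittagLefflerKernel_one_atTop hα₀ hα₁).comp
    (tendsto_id.atTop_div_const hτ₀)
  tendsto_ratio_atTop := by
    have h := ((tendsto_mittagLefflerKernel_one_div_self_atTop hα₀ hα₁).comp
      (tendsto_id.atTop_div_const hτ₀)).const_mul_atTop hτ₀
    refine h.congr fun t => ?_
    simp only [Function.comp, id]
    rw [div_div_eq_mul_div]; ring
  tendsto_ratio_zero := by
    have h1 : Tendsto (fun t : ℝ => t / τ₀) (𝓝[>] 0) (𝓝[>] 0) := by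
      refine tendsto_nhdsWithin_iff.2 ⟨?_, ?_⟩
      · have hc : Continuous fun t : ℝ => t / τ₀ := continuous_id.div_const τ₀
        simpa using (hc.tendsto 0).mono_left (nhdsWithin_le_nhds (s := Ioi 0))
      · filter_upwards [self_mem_nhdsWithin] with t ht
        exact div_pos ht hτ₀
    have h := ((tendsto_mittagLefflerKernel_one_div_self_zero hα₀ hα₁).comp h1).const_mul τ₀
    rw [mul_zero] at h
    refine h.congr fun t => ?_
    simp only [Function.comp]
    rw [div_div_eq_mul_div]; ring

theorem relaxationStress_eq (α τ₀ k₀ : ℝ) :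
    relaxationStress α τ₀ k₀ = fun s => k₀ * mittagLefflerKernel α 1 (s / τ₀) := by
  funext s
  rw [relaxationStress, mittagLefflerKernel_one]

theorem IntervalIntegrable.comp_div_pos {f : ℝ → ℝ} {t c : ℝ} (hc : 0 < c)
    (hf : IntervalIntegrable f volume 0 (t / c)) :
    IntervalIntegrable (fun x => f (x / c)) volume 0 t := by
  have h := hf.comp_mul_left (c := c⁻¹)
  rw [zero_div, div_inv_eq_mul, div_mul_cancel₀ t hc.ne'] at h
  exact h.congr fun x _ => by simp only [div_eq_inv_mul]

theorem isFractionalMaxwellRelaxation_relaxationStress {α τ₀ : ℝ} (k₀ : ℝ) (hα₀ : 0 < α)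
    (hα₁ : α < 1) (hτ₀ : 0 < τ₀) :
    IsFractionalMaxwellRelaxation α τ₀ (relaxationStress α τ₀ k₀) := by
  have hd : ∀ s, 0 < s → deriv (relaxationStress α τ₀ k₀) s =
      k₀ * -(mittagLefflerKernel α α (s / τ₀) / τ₀) := fun s hs => by
    rw [relaxationStress_eq]
    exact (((isRelaxationProfile_mittagLeffler hα₀ hα₁ hτ₀).hasDerivAt s hs).const_mul k₀).deriv
  have hk : ∀ t, 0 < t → EqOn (fun s => (t - s) ^ (-α) * deriv (relaxationStress α τ₀ k₀) s)
      (fun s => (-k₀ / τ₀ * τ₀ ^ (-α)) *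
        ((t / τ₀ - s / τ₀) ^ (-α) * mittagLefflerKernel α α (s / τ₀))) (Ioc 0 t) := by
    intro t ht s hs
    have h1 : t - s = τ₀ * (t / τ₀ - s / τ₀) := by field_simp
    have h2 : 0 ≤ t / τ₀ - s / τ₀ := by
      rw [← sub_div]
      exact div_nonneg (sub_nonneg.2 hs.2) hτ₀.le
    simp only
    rw [hd s hs.1, h1, Real.mul_rpow hτ₀.le h2]
    ring
  refine ⟨fun T hT => ?_, fun t ht => ?_, fun t ht => ?_⟩
  -- The derivative is singular at `0` but integrable, so the stress is absolutely continuous as a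
  -- constant plus an indefinite integral.
  · have hi := (intervalIntegrable_mittagLefflerKernel_self hα₀ hα₁
      (div_pos hT hτ₀).le).comp_div_pos hτ₀
    refine (((hi.absolutelyContinuousOnInterval_intervalIntegral left_mem_uIcc).const_mul
      (-k₀ / τ₀)).const_add k₀).congr fun s hs => ?_
    rw [uIcc_of_le hT.le] at hs
    simp only [relaxationStress_eq]
    rw [intervalIntegral.integral_comp_div _ hτ₀.ne', zero_div,
      mittagLefflerKernel_one_eq_sub_integral hα₀ hα₁ (div_nonneg hs.1 hτ₀.le), smul_eq_mul]
    field_simp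
    ring
  · have hi := ((intervalIntegrable_sub_rpow_neg_mul_mittagLefflerKernel hα₀ hα₁
      (div_pos ht hτ₀)).comp_div_pos hτ₀).const_mul (-k₀ / τ₀ * τ₀ ^ (-α))
    refine hi.congr ?_
    rw [uIoc_of_le ht.le]
    exact (hk t ht).symm
  · have hG := Real.Gamma_pos_of_pos (sub_pos.2 hα₁)
    have hp := Real.rpow_pos_of_pos hτ₀ α
    rw [caputoDeriv, intervalIntegral.integral_of_le ht.le,
      setIntegral_congr_fun measurableSet_Ioc (hk t ht), ← intervalIntegral.integral_of_le ht.le,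
      intervalIntegral.integral_const_mul,
      intervalIntegral.integral_comp_div
        (fun r => (t / τ₀ - r) ^ (-α) * mittagLefflerKernel α α r) hτ₀.ne', zero_div,
      integral_sub_rpow_neg_mul_mittagLefflerKernel hα₀ hα₁ (div_pos ht hτ₀), smul_eq_mul,
      relaxationStress_eq, Real.rpow_neg hτ₀.le]
    field_simp
    ring

theorem memLp_two_mittagLeffler_iff {α τ₀ : ℝ} (hα₀ : 0 < α) (hα₁ : α < 1) (hτ₀ : 0 < τ₀) :
    MemLp (fun s : ℝ => mittagLeffler α (-(s / τ₀) ^ α)) 2 (volume.restrict (Ici 0)) ↔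
      IntegrableOn (fun s => mittagLefflerKernel α 1 (s / τ₀) ^ 2) (Ioi 0) := by
  simp_rw [← mittagLefflerKernel_one]
  rw [memLp_two_iff_integrable_sq
    (isRelaxationProfile_mittagLeffler hα₀ hα₁ hτ₀).continuous.aestronglyMeasurable]
  exact integrableOn_Ici_iff_integrableOn_Ioi

theorem integrableOn_sq_mittagLefflerKernel_div_iff {α τ₀ : ℝ} (hα₀ : 0 < α) (hα₁ : α < 1)
    (hτ₀ : 0 < τ₀) :
    IntegrableOn (fun s => mittagLefflerKernel α 1 (s / τ₀) ^ 2) (Ioi 0) ↔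
      α ∈ Ioo (1 / 2 : ℝ) 1 := by
  have h := integrableOn_Ioi_comp_mul_left_iff (fun s => mittagLefflerKernel α 1 s ^ 2) 0
    (inv_pos.2 hτ₀)
  simp only [mul_zero, ← div_eq_inv_mul] at h
  rw [h, integrableOn_sq_mittagLefflerKernel_one_iff hα₀ hα₁]
  exact ⟨fun h => ⟨h, hα₁⟩, fun h => h.1⟩

theorem theorem1 (α τ₀ k₀ ρ ε₀ e₀ : ℝ) (μ : ℝ → ℝ)
    (hα₀ : 0 < α) (hα₁ : α < 1) (hτ₀ : 0 < τ₀) (hk₀ : 0 < k₀) (hρ : 0 < ρ) (hμ : 0 < μ ε₀) :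
    -- the parametric form defines the energy as a function of the stress on `(0, k₀]`
    BijOn (relaxationStress α τ₀ k₀) (Ici 0) (Ioc 0 k₀) ∧
    (∃ eV : ℝ → ℝ, IsViscousEnergy α τ₀ k₀ ρ (μ ε₀) e₀ eV) ∧
    ∀ eV : ℝ → ℝ, IsViscousEnergy α τ₀ k₀ ρ (μ ε₀) e₀ eV →
      DifferentiableOn ℝ eV (Ioc 0 k₀) ∧
      -- the common solution, with initial value `k₀`
      (relaxationStress α τ₀ k₀ 0 = k₀ ∧
        IsNonlinearRelaxation ρ μ k₀ eV ε₀ (relaxationStress α τ₀ k₀) ∧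
        IsFractionalMaxwellRelaxation α τ₀ (relaxationStress α τ₀ k₀)) ∧
      -- no other initial value admits a common solution
      (∀ σ : ℝ → ℝ, IsNonlinearRelaxation ρ μ k₀ eV ε₀ σ →
        IsFractionalMaxwellRelaxation α τ₀ σ → σ 0 = k₀) ∧
      -- boundedness of the energy
      ((∃ C : ℝ, ∀ σ ∈ Icc 0 k₀, |eV σ| ≤ C) ↔
        MemLp (fun s : ℝ => mittagLeffler α (-(s / τ₀) ^ α)) 2 (volume.restrict (Ici 0))) ∧
      (MemLp (fun s : ℝ => mittagLeffler α (-(s / τ₀) ^ α)) 2 (volume.restrict (Ici 0)) ↔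
        α ∈ Ioo (1 / 2 : ℝ) 1) ∧
      -- the nonlinear relaxation time
      (∀ σ ∈ Ioo 0 k₀, 0 < relaxationTime ρ μ k₀ eV ε₀ σ) ∧
      Tendsto (relaxationTime ρ μ k₀ eV ε₀) (𝓝[>] 0) atTop ∧
      relaxationTime ρ μ k₀ eV ε₀ k₀ = 0 ∧
      Tendsto (relaxationTime ρ μ k₀ eV ε₀) (𝓝[<] k₀) (𝓝 0) ∧
      -- the choice of the additive constant
      (α ∈ Ioo (1 / 2 : ℝ) 1 →
        e₀ = k₀ ^ 2 / (ρ * μ ε₀) *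
          ∫ s in Ici (0 : ℝ), (mittagLeffler α (-(s / τ₀) ^ α)) ^ 2 →
        Tendsto eV (𝓝[>] 0) (𝓝 0)) := by
  have h := isRelaxationProfile_mittagLeffler hα₀ hα₁ hτ₀
  have hc : 0 < k₀ ^ 2 / (ρ * μ ε₀) := by positivity
  have hfun : ∀ s, mittagLeffler α (-(s / τ₀) ^ α) = mittagLefflerKernel α 1 (s / τ₀) :=
    fun s => (mittagLefflerKernel_one α (s / τ₀)).symm
  have hpar : ∀ s, parametricEnergy α τ₀ k₀ ρ (μ ε₀) e₀ s = e₀ - k₀ ^ 2 / (ρ * μ ε₀) *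
      ∫ r in (0 : ℝ)..s, mittagLefflerKernel α 1 (r / τ₀) ^ 2 := fun s => by
    simp only [parametricEnergy, hfun]
  have hfrac := isFractionalMaxwellRelaxation_relaxationStress k₀ hα₀ hα₁ hτ₀
  rw [memLp_two_mittagLeffler_iff hα₀ hα₁ hτ₀]
  simp only [hfun]
  unfold IsViscousEnergy
  rw [relaxationStress_eq] at hfrac ⊢
  simp only [hpar]
  refine ⟨h.bijOn hk₀, h.exists_energy hk₀ _, fun eV hE => ?_⟩
  refine ⟨h.differentiableOn_energy hk₀ hE,
    ⟨by rw [h.zero, mul_one], h.isNonlinearRelaxation hk₀ hρ hμ hE, hfrac⟩, ?_,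
    h.bounded_energy_iff hk₀ hc hE, integrableOn_sq_mittagLefflerKernel_div_iff hα₀ hα₁ hτ₀,
    fun σ hσ => h.relaxationTime_pos hk₀ hρ hμ hE hσ, h.tendsto_relaxationTime_zero hk₀ hρ hμ hE,
    h.relaxationTime_right hk₀ hE, h.tendsto_relaxationTime_right hk₀ hρ hμ hE, ?_⟩
  · intro σ hσ hσf
    obtain ⟨d, hd, hshift⟩ := h.exists_eq_shift hk₀ hρ hμ hE hσ
    have h0 := hshift 0 le_rfl
    rcases hd.eq_or_lt with rfl | hd
    · rw [h0, add_zero, h.zero, mul_one]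
    -- For `d > 0` the times `s + d` with `0 < s ≤ 1` stay away from the singularity of the rate at
    -- `0`.
    · obtain ⟨M, hM⟩ := (isCompact_Icc (a := d) (b := 1 + d)).exists_bound_of_continuousOn
        (h.rate_continuousOn.mono fun s hs => hd.trans_le hs.1)
      have h1 : σ 0 = 0 := by
        refine hσf.apply_zero_of_bounded_deriv (M := k₀ * M) hα₁
          ((hσ.continuousOn 0 self_mem_Ici).mono Ioi_subset_Ici_self) fun s hs => ?_
        have h2 := (((h.hasDerivAt (s + d) (by linarith [hs.1])).comp_add_const s d).const_mul
          k₀).congr_of_eventuallyEq (f₁ := σ) (by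
            filter_upwards [Ioi_mem_nhds hs.1] with t ht
            exact hshift t (le_of_lt ht))
        rw [h2.deriv, abs_mul, abs_of_pos hk₀, abs_neg]
        gcongr
        exact hM (s + d) ⟨by linarith [hs.1], by linarith [hs.2]⟩
      rw [h1] at h0
      have := mul_pos hk₀ (h.pos (by linarith : 0 ≤ 0 + d))
      linarith
  · intro hα he
    have h1 := h.tendsto_energy_zero hk₀ hE
      ((integrableOn_sq_mittagLefflerKernel_div_iff hα₀ hα₁ hτ₀).2 hα)
    rwa [he, integral_Ici_eq_integral_Ioi, sub_self] at h1
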